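/- Let $\mathbb F$ be an algebraically closed field and let $G(\lambda)\in\mathbb F(\lambda)^{p\times m}$ be a rational matrix. **Conventions.** Write uniquely $G=Q+G_{sp}$ with $Q$ a polynomial matrix and $G_{sp}$ strictly proper, and let $g_G:=\deg Q$ if $G$ is not strictly proper, $g_G:=0$ otherwise. For an integer $g$ let $\operatorname{rev}_gG(\lambda):=\lambda^gG(1/\lambda)$, and let $\operatorname{rev}G:=\operatorname{rev}_{g_G}G$. A square rational matrix $R$ is regular at $\lambda_0\in\mathbb F$ if it is defined at $\lambda_0$ and $\det R(\lambda_0)\ne0$. For rational matrices $G$ ($p\times m$) and $H$ ($q\times r$) write $G\sim_{\lambda_0}H$ if there are integers $s_1,s_2\ge0$ with $s_1-s_2=q-p=r-m$ and square rational matrices $R_1,R_2$ regular at $\lambda_0$ with $R_1\operatorname{diag}(G,I_{s_1})R_2=\operatorname{diag}(H,I_{s_2})$. A linear polynomial system matrix is a matrix $$\mathcal L(\lambda)=\begin{bmatrix}A(\lambda)&B(\lambda)\\-C(\lambda)&D(\lambda)\end{bmatrix}=\begin{bmatrix}A_1\lambda+A_0&B_1\lambda+B_0\\-(C_1\lambda+C_0)&D_1\lambda+D_0\end{bmatrix}\in\mathbb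 F[\lambda]^{(n+q)\times(n+r)}$$ with this partition, where $A(\lambda)$ is $n\times n$ and $\det A(\lambda)\not\equiv0$ if $n>0$. Its transfer function matrix is $\widehat G=D+CA^{-1}B\in\mathbb F(\lambda)^{q\times r}$ ($\widehat G=D$ if $n=0$). Such a matrix is minimal at $\lambda_0\in\mathbb F$ if $\operatorname{rank}\begin{bmatrix}A(\lambda_0)\\C(\lambda_0)\end{bmatrix}=\operatorname{rank}\begin{bmatrix}A(\lambda_0)&B(\lambda_0)\end{bmatrix}=n$ (automatic if $n=0$). Let $\ell:=\deg\mathcal L\in\{0,1\}$ ($\ell=0$ if $\mathcal L$ is constant). * $\mathcal L$ is a linearization of $G$ in $\mathbb F$ if, for every $\lambda_0\in\mathbb F$, $\mathcal L$ is minimal at $\lambda_0$ and $G\sim_{\lambda_0}\widehat G$. * For an integer $g$, $\mathcal L$ is a $g$-strong linearization of $G$ if it is a linearization of $G$ in $\mathbb F$, $\operatorname{rev}_\ell\mathcal L$ (with the same partition) is minimal at $0$, and $\operatorname{rev}_gG\sim_0\operatorname{rev}_\ell\widehat G$. * $\mathcal L$ is a strong linearization of $G$ in the sense of Amparan, Dopico,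 Marcaida and Zaballa if it is a linearization of $G$ in $\mathbb F$, $A_1$ is invertible if $n>0$, and $\operatorname{rev}G\sim_0\operatorname{rev}\widehat G$. **Proposition.** Let $\mathcal L(\lambda)$ be a strong linearization of $G(\lambda)$ in the sense of Amparan, Dopico, Marcaida and Zaballa. Then: (a) If $n=0$ or $D_1+C_1A_1^{-1}B_1\ne0$, then $\mathcal L$ is a $g_G$-strong linearization of $G$. (b) If $n>0$, $D_1+C_1A_1^{-1}B_1=0$, $q=p$ and $r=m$, then $\mathcal L$ is a $(g_G+1)$-strong linearization of $G$. (c) If $n>0$, $D_1+C_1A_1^{-1}B_1=0$, and $q\ne p$ or $r\ne m$, then $\mathcal L$ is not a $g$-strong linearization of $G$ for any integer $g$. -/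

import Mathlib

open scoped Polynomial

namespace RatLin

noncomputable section

/-! ### Rational matrices: values, regularity, strictly proper and polynomial parts -/

/-- The degree of a polynomial matrix: the largest exponent of the variable that occurs in an entry
with nonzero coefficient (and `0` for the zero matrix and for empty matrices). -/
def matDegree {F : Type*} [Field F] {a b : Type*} [Fintype a] [Fintype b]
    (P : Matrix a b F[X]) : ℕ :=
  Finset.univ.sup fun i => Finset.univ.sup fun j => (P i j).natDegree

/-- A polynomial matrix, seen as a rational matrix. -/
def toRat {F : Type*} [Field F] {a b : Type*} (P : Matrix a b F[X]) : Matrix a b (RatFunc F) :=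
  P.map (algebraMap F[X] (RatFunc F))

/-- The rational matrix `R` is defined at the point `x₀` (recall that `RatFunc.num` and
`RatFunc.denom` are coprime). -/
def IsDefinedAt {F : Type*} [Field F] {a b : Type*} (x₀ : F) (R : Matrix a b (RatFunc F)) : Prop :=
  ∀ i j, (R i j).denom.eval x₀ ≠ 0

/-- The value at `x₀` of a rational matrix that is defined at `x₀`. -/
def valueAt {F : Type*} [Field F] {a b : Type*} (x₀ : F) (R : Matrix a b (RatFunc F)) :
    Matrix a b F :=
  R.map (RatFunc.eval (RingHom.id F) x₀)

/-- The square rational matrix `R` is regular (invertible) at `x₀`. -/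
def IsRegularAt {F : Type*} [Field F] {a : Type*} [Fintype a] [DecidableEq a]
    (x₀ : F) (R : Matrix a a (RatFunc F)) : Prop :=
  IsDefinedAt x₀ R ∧ (valueAt x₀ R).det ≠ 0

/-- All entries of the rational matrix are strictly proper. -/
def IsStrictlyProper {F : Type*} [Field F] {a b : Type*} (R : Matrix a b (RatFunc F)) : Prop :=
  ∀ i j, (R i j).num.degree < (R i j).denom.degree

/-- The polynomial part `Q` in the decomposition `G = Q + G_sp` with `G_sp` strictly proper: the
entrywise quotients of the Euclidean division of numerators by denominators. -/
def polyPart {F : Type*} [Field F] {a b : Type*} (G : Matrix a b (RatFunc F)) : Matrix a b F[X] :=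
  G.map fun f => f.num / f.denom

/-- The integer `g_G`: the degree of the polynomial part of `G` if `G` is not strictly proper, and
`0` if `G` is strictly proper (the polynomial part is then the zero matrix). -/
def polyGrade {F : Type*} [Field F] {a b : Type*} [Fintype a] [Fintype b]
    (G : Matrix a b (RatFunc F)) : ℕ :=
  matDegree (polyPart G)

/-! ### Reversals -/

/-- The `g`-reversal `λ ^ g * G (1 / λ)` of a rational matrix, for an integer `g`. -/
def revGrade {F : Type*} [Field F] {a b : Type*} (g : ℤ) (G : Matrix a b (RatFunc F)) :
    Matrix a b (RatFunc F) :=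
  G.map fun f => RatFunc.X ^ g * f.eval RatFunc.C (RatFunc.X)⁻¹

/-- The reversal `rev G` of a rational matrix `G`: its `g`-reversal for `g = g_G`. -/
def rev {F : Type*} [Field F] {a b : Type*} [Fintype a] [Fintype b]
    (G : Matrix a b (RatFunc F)) : Matrix a b (RatFunc F) :=
  revGrade (polyGrade G) G

/-- The `d`-reversal `λ ^ d * P (1 / λ)` of a polynomial matrix `P` of degree at most `d`. -/
def revPoly {F : Type*} [Field F] {a b : Type*} (d : ℕ) (P : Matrix a b F[X]) : Matrix a b F[X] :=
  P.map (Polynomial.reflect d)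

/-! ### Equivalence at a point of matrices extended by identity blocks -/

/-- The block diagonal matrix `diag (G, I_s)`, of size `(p + s) × (m + s)`. -/
def diagOne {F : Type*} [Field F] {p m : ℕ} (G : Matrix (Fin p) (Fin m) (RatFunc F)) (s : ℕ) :
    Matrix (Fin (p + s)) (Fin (m + s)) (RatFunc F) :=
  (Matrix.fromBlocks G 0 0 (1 : Matrix (Fin s) (Fin s) (RatFunc F))).submatrix
    finSumFinEquiv.symm finSumFinEquiv.symm

/-- There are nonnegative integers `s₁, s₂` with `s₁ - s₂ = q - p = r - m` and matrices `R₁, R₂`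
regular at `x₀` such that `R₁ * diag (G, I_{s₁}) * R₂ = diag (H, I_{s₂})`. The condition on `s₁, s₂`
says that the two block diagonal matrices have the same size; `Fin.cast` is the resulting
identification of the indices. -/
def ExtEquivAt {F : Type*} [Field F] {p m q r : ℕ} (x₀ : F)
    (G : Matrix (Fin p) (Fin m) (RatFunc F)) (H : Matrix (Fin q) (Fin r) (RatFunc F)) : Prop :=
  ∃ (s₁ s₂ : ℕ) (hrow : p + s₁ = q + s₂) (hcol : m + s₁ = r + s₂)
    (R₁ : Matrix (Fin (p + s₁)) (Fin (p + s₁)) (RatFunc F))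
    (R₂ : Matrix (Fin (m + s₁)) (Fin (m + s₁)) (RatFunc F)),
    IsRegularAt x₀ R₁ ∧ IsRegularAt x₀ R₂ ∧
      R₁ * diagOne G s₁ * R₂ = (diagOne H s₂).submatrix (Fin.cast hrow) (Fin.cast hcol)

/-! ### Linear polynomial system matrices -/

/-- The pencil `M₁ λ + M₀`. -/
def pencil {F : Type*} [Field F] {a b : Type*} (M₁ M₀ : Matrix a b F) : Matrix a b F[X] :=
  M₁.map (fun c => Polynomial.C c * Polynomial.X) + M₀.map Polynomial.C

/-- A linear polynomial system matrix
`[A₁ λ + A₀, B₁ λ + B₀; -(C₁ λ + C₀), D₁ λ + D₀]` of size `(n + q) × (n + r)`, with its partition;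
the state matrix `A₁ λ + A₀` is nonsingular (no condition if `n = 0`, where the determinant
is `1`). -/
structure LinearSystemMatrix (F : Type*) [Field F] (n q r : ℕ) where
  /-- coefficients of the state matrix -/
  A₁ : Matrix (Fin n) (Fin n) F
  A₀ : Matrix (Fin n) (Fin n) F
  B₁ : Matrix (Fin n) (Fin r) F
  B₀ : Matrix (Fin n) (Fin r) F
  C₁ : Matrix (Fin q) (Fin n) F
  C₀ : Matrix (Fin q) (Fin n) F
  D₁ : Matrix (Fin q) (Fin r) F
  D₀ : Matrix (Fin q) (Fin r) F
  nonsingular : (pencil A₁ A₀).det ≠ 0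

/-- The system matrix with blocks `A, B, C` (and any `D`) is minimal at `x₀`:
`rank [A(x₀); C(x₀)] = rank [A(x₀), B(x₀)] = n`. This holds automatically if `n = 0`. -/
def IsMinimalAt {F : Type*} [Field F] {n q r : ℕ} (A : Matrix (Fin n) (Fin n) F[X])
    (B : Matrix (Fin n) (Fin r) F[X]) (C : Matrix (Fin q) (Fin n) F[X]) (x₀ : F) : Prop :=
  (Matrix.fromRows (A.map (Polynomial.eval x₀)) (C.map (Polynomial.eval x₀))).rank = n ∧
    (Matrix.fromCols (A.map (Polynomial.eval x₀)) (B.map (Polynomial.eval x₀))).rank = n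

namespace LinearSystemMatrix

/-- The block `A₁ λ + A₀`. -/
def A {F : Type*} [Field F] {n q r : ℕ} (L : LinearSystemMatrix F n q r) :
    Matrix (Fin n) (Fin n) F[X] := pencil L.A₁ L.A₀

/-- The block `B₁ λ + B₀`. -/
def B {F : Type*} [Field F] {n q r : ℕ} (L : LinearSystemMatrix F n q r) :
    Matrix (Fin n) (Fin r) F[X] := pencil L.B₁ L.B₀

/-- The block `C₁ λ + C₀`. -/
def C {F : Type*} [Field F] {n q r : ℕ} (L : LinearSystemMatrix F n q r) :
    Matrix (Fin q) (Fin n) F[X] := pencil L.C₁ L.C₀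

/-- The block `D₁ λ + D₀`. -/
def D {F : Type*} [Field F] {n q r : ℕ} (L : LinearSystemMatrix F n q r) :
    Matrix (Fin q) (Fin r) F[X] := pencil L.D₁ L.D₀

/-- The polynomial matrix `[A, B; -C, D]`. -/
def toMatrix {F : Type*} [Field F] {n q r : ℕ} (L : LinearSystemMatrix F n q r) :
    Matrix (Fin n ⊕ Fin q) (Fin n ⊕ Fin r) F[X] :=
  Matrix.fromBlocks L.A L.B (-L.C) L.D

/-- The degree (`0` or `1`) of the system matrix. -/
def degree {F : Type*} [Field F] {n q r : ℕ} (L : LinearSystemMatrix F n q r) : ℕ :=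
  matDegree L.toMatrix

/-- The transfer function matrix `D + C * A⁻¹ * B`. -/
def transfer {F : Type*} [Field F] {n q r : ℕ} (L : LinearSystemMatrix F n q r) :
    Matrix (Fin q) (Fin r) (RatFunc F) :=
  toRat L.D + toRat L.C * (toRat L.A)⁻¹ * toRat L.B

/-- `L` is a linearization of `G` at the point `x₀`. -/
def IsLinearizationAt {F : Type*} [Field F] {n q r p m : ℕ} (L : LinearSystemMatrix F n q r)
    (G : Matrix (Fin p) (Fin m) (RatFunc F)) (x₀ : F) : Prop :=
  IsMinimalAt L.A L.B L.C x₀ ∧ ExtEquivAt x₀ G L.transfer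

/-- `L` is a linearization of `G` in the subset `S` of the field. -/
def IsLinearizationOn {F : Type*} [Field F] {n q r p m : ℕ} (L : LinearSystemMatrix F n q r)
    (G : Matrix (Fin p) (Fin m) (RatFunc F)) (S : Set F) : Prop :=
  ∀ x₀ ∈ S, L.IsLinearizationAt G x₀

/-- `L` is a linearization of `G` at infinity of grade `g`: with `ℓ` the degree of `L`, the system
matrix `rev L = rev_ℓ L` is minimal at `0`, and `rev_g G` and `rev_ℓ` of the transfer function
matrix, extended by identities, are equivalent at `0`. -/
def IsLinearizationAtInfty {F : Type*} [Field F] {n q r p m : ℕ} (L : LinearSystemMatrix F n q r)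
    (G : Matrix (Fin p) (Fin m) (RatFunc F)) (g : ℤ) : Prop :=
  IsMinimalAt (revPoly L.degree L.A) (revPoly L.degree L.B) (revPoly L.degree L.C) 0 ∧
    ExtEquivAt 0 (revGrade g G) (revGrade (L.degree : ℤ) L.transfer)

/-- `L` is a `g`-strong linearization of `G`. -/
def IsGradeStrongLinearization {F : Type*} [Field F] {n q r p m : ℕ}
    (L : LinearSystemMatrix F n q r) (G : Matrix (Fin p) (Fin m) (RatFunc F)) (g : ℤ) : Prop :=
  L.IsLinearizationOn G Set.univ ∧ L.IsLinearizationAtInfty G g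

/-- `L` is a strong linearization of `G` in the sense of Amparan, Dopico, Marcaida and Zaballa. -/
def IsStrongLinearization {F : Type*} [Field F] {n q r p m : ℕ}
    (L : LinearSystemMatrix F n q r) (G : Matrix (Fin p) (Fin m) (RatFunc F)) : Prop :=
  L.IsLinearizationOn G Set.univ ∧ (0 < n → IsUnit L.A₁) ∧ ExtEquivAt 0 (rev G) (rev L.transfer)

end LinearSystemMatrix

/-! ### The decomposition into polynomial and strictly proper part -/

theorem isStrictlyProper_entry {F : Type*} [Field F] {f : RatFunc F} {u v : F[X]}
    (h : f * algebraMap F[X] (RatFunc F) v = algebraMap F[X] (RatFunc F) u)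
    (huv : u.degree < v.degree) : f.num.degree < f.denom.degree := by
  have hd := RatFunc.denom_ne_zero f
  have hd' : algebraMap F[X] (RatFunc F) f.denom ≠ 0 := RatFunc.algebraMap_ne_zero hd
  have key : f.num * v = u * f.denom := by
    apply RatFunc.algebraMap_injective F
    rw [map_mul, map_mul, ← h]
    nth_rewrite 2 [← RatFunc.num_div_denom f]
    field_simp
  have hdeg := congrArg Polynomial.degree key
  rw [Polynomial.degree_mul, Polynomial.degree_mul] at hdeg
  by_contra hcon
  have h1 : f.denom.degree + u.degree < f.denom.degree + v.degree :=
    WithBot.add_lt_add_left (by simpa [Polynomial.degree_eq_bot] using hd) huv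
  have h2 : f.denom.degree + v.degree ≤ f.num.degree + v.degree := by
    gcongr
    exact not_lt.mp hcon
  rw [hdeg, add_comm u.degree] at h2
  exact absurd h1 (not_lt.mpr h2)

/-- `G` is the sum of its polynomial part and a strictly proper matrix. -/
theorem isStrictlyProper_sub_polyPart {F : Type*} [Field F] {a b : Type*}
    (G : Matrix a b (RatFunc F)) : IsStrictlyProper (G - toRat (polyPart G)) := by
  intro i j
  have hd := RatFunc.denom_ne_zero (G i j)
  have hd' : algebraMap F[X] (RatFunc F) (G i j).denom ≠ 0 := RatFunc.algebraMap_ne_zero hd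
  refine isStrictlyProper_entry (u := (G i j).num % (G i j).denom) ?_
    (EuclideanDomain.mod_lt _ hd)
  have h1 := congrArg (algebraMap F[X] (RatFunc F))
    (EuclideanDomain.mod_add_div (G i j).num (G i j).denom)
  rw [map_add, map_mul] at h1
  have h2 : G i j * algebraMap F[X] (RatFunc F) (G i j).denom
      = algebraMap F[X] (RatFunc F) (G i j).num := by
    nth_rewrite 1 [← RatFunc.num_div_denom (G i j)]
    field_simp
  simp only [Matrix.sub_apply, toRat, polyPart, Matrix.map_apply, sub_mul]
  rw [h2, ← h1]
  ring

/-- The decomposition is unique. -/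
theorem polyPart_eq {F : Type*} [Field F] {a b : Type*} (G S : Matrix a b (RatFunc F))
    (Q : Matrix a b F[X]) (hG : G = toRat Q + S) (hS : IsStrictlyProper S) :
    polyPart G = Q := by
  ext1 i j
  have hg := congrFun (congrFun hG i) j
  simp only [Matrix.add_apply, toRat, Matrix.map_apply] at hg
  have hT := isStrictlyProper_sub_polyPart G i j
  simp only [Matrix.sub_apply, toRat, Matrix.map_apply] at hT
  set T : RatFunc F := G i j - algebraMap F[X] (RatFunc F) (polyPart G i j) with hTdef
  have hs := hS i j
  have hd1 := RatFunc.denom_ne_zero (S i j)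
  have hd2 := RatFunc.denom_ne_zero T
  have e1 : S i j * algebraMap F[X] (RatFunc F) (S i j).denom
      = algebraMap F[X] (RatFunc F) (S i j).num := by
    have := RatFunc.algebraMap_ne_zero hd1
    nth_rewrite 1 [← RatFunc.num_div_denom (S i j)]
    field_simp
  have e2 : T * algebraMap F[X] (RatFunc F) T.denom = algebraMap F[X] (RatFunc F) T.num := by
    have := RatFunc.algebraMap_ne_zero hd2
    nth_rewrite 1 [← RatFunc.num_div_denom T]
    field_simp
  have key : (polyPart G i j - Q i j) * ((S i j).denom * T.denom)
      = (S i j).num * T.denom - T.num * (S i j).denom := by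
    apply RatFunc.algebraMap_injective F
    simp only [map_mul, map_sub]
    rw [← e1, ← e2, hTdef, hg]
    ring
  by_contra hne
  have hz : polyPart G i j - Q i j ≠ 0 := sub_ne_zero.mpr hne
  have hlt : ((S i j).num * T.denom - T.num * (S i j).denom).degree
      < ((S i j).denom * T.denom).degree := by
    refine lt_of_le_of_lt (Polynomial.degree_sub_le _ _) (max_lt ?_ ?_)
    · rw [Polynomial.degree_mul, Polynomial.degree_mul]
      exact WithBot.add_lt_add_right (by simpa [Polynomial.degree_eq_bot] using hd2) hs
    · rw [Polynomial.degree_mul, Polynomial.degree_mul, add_comm]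
      exact WithBot.add_lt_add_left (by simpa [Polynomial.degree_eq_bot] using hd1) hT
  rw [← key, mul_comm] at hlt
  exact absurd hlt (not_lt.mpr (Polynomial.degree_le_mul_left _ hz))

/-- A strictly proper matrix has `g_G = 0`. -/
theorem polyGrade_eq_zero {F : Type*} [Field F] {a b : Type*} [Fintype a] [Fintype b]
    (G : Matrix a b (RatFunc F)) (hG : IsStrictlyProper G) : polyGrade G = 0 := by
  have h : polyPart G = 0 := polyPart_eq G G 0 (by ext1 i j; simp [toRat]) hG
  simp [polyGrade, h, matDegree]

end

end RatLin

/-!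
Everything takes place over the local ring of a point of the affine line. A matrix regular at the
point is one that is invertible over this ring, so extension equivalence says that `diag (G, I)` and
`diag (H, I)` are equivalent over the local ring (`LocalEquiv`).

The substitution of `1 / λ` turns behaviour at infinity into behaviour at the origin: the degree of
the polynomial part of `G` is the least `d` for which `λ ^ d * G (1 / λ)` is defined at the origin
(`polyGrade_le_iff`). If `A₁` is invertible, the reversal of grade `1` of the transfer function
matrix is the transfer function matrix of the reversed system, whose state matrix is `A₁` at the
origin; hence it is defined there, with value `E = D₁ + C₁ * A₁⁻¹ * B₁`
(`revGrade_one_transfer_at_zero`). So the transfer function matrix has grade `1` if `E ≠ 0` and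
grade `0` if `E = 0`, while the system matrix has degree `1` and its reversal is minimal at the
origin. If `E ≠ 0` the two notions of reversal of the transfer function matrix therefore coincide,
as they do for `n = 0`, where the transfer function matrix is the polynomial matrix `D`.

If `E = 0`, they differ by a factor `λ`, and the question is whether an equivalence of `diag (G, I)`
and `diag (H, I)`, where `G` and `H` now denote the two reversals and `H` is defined at the origin,
gives one with `λ * H` in place of `H` and some `λ ^ k * G` in place of `G`. For equal sizes it does,
with `k = 1`, since identity blocks can be cancelled over a local ring (`LocalEquiv.cancel`) and
scaling is then harmless. For different sizes it does not (`not_extEquivAt_of_size_ne`): comparing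
the identity blocks with the rank of the value at the origin (`LocalEquiv.card_le`) leaves only the
case `k = 0`, in which `H` is equivalent to `λ * H`, hence divisible by all powers of `λ`, hence zero.
But the transfer function matrix is not zero: `det A` has degree `n > 0` and so has a root, and a
system minimal at that root has a pole there (`det_eval_ne_zero_of_transfer_eq_zero`).
-/

namespace RatLin

/-! ### The local ring of rational functions defined at a point -/

section LocalRing

variable {F : Type*} [Field F] {a b c d : Type*}

/-- The local ring of a point `x₀` of the affine line: the rational functions defined at `x₀`. -/
def localRing (x₀ : F) : Subring (RatFunc F) where
  carrier := {f | f.denom.eval x₀ ≠ 0}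
  mul_mem' {f g} hf hg := by
    obtain ⟨w, hw⟩ := RatFunc.denom_mul_dvd f g
    intro h0
    have := congrArg (Polynomial.eval x₀) hw
    simp only [Polynomial.eval_mul, h0, zero_mul] at this
    exact mul_ne_zero hf hg this
  add_mem' {f g} hf hg := by
    obtain ⟨w, hw⟩ := RatFunc.denom_add_dvd f g
    intro h0
    have := congrArg (Polynomial.eval x₀) hw
    simp only [Polynomial.eval_mul, h0, zero_mul] at this
    exact mul_ne_zero hf hg this
  one_mem' := by simp
  zero_mem' := by simp
  neg_mem' {f} hf := by
    have hd := RatFunc.denom_ne_zero f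
    have h : (-f).denom ∣ f.denom := by
      rw [RatFunc.denom_dvd hd]
      refine ⟨-f.num, ?_⟩
      rw [map_neg, neg_div, RatFunc.num_div_denom]
    obtain ⟨w, hw⟩ := h
    intro h0
    have := congrArg (Polynomial.eval x₀) hw
    simp only [Polynomial.eval_mul, h0, zero_mul] at this
    exact hf this

theorem mem_localRing_of_mul_eq {x₀ : F} {f : RatFunc F} {u v : F[X]}
    (h : f * algebraMap F[X] (RatFunc F) v = algebraMap F[X] (RatFunc F) u)
    (hv : v.eval x₀ ≠ 0) : f ∈ localRing x₀ := by
  have hv0 : v ≠ 0 := by rintro rfl; simp at hv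
  have hd : f.denom ∣ v := by
    rw [RatFunc.denom_dvd hv0]
    exact ⟨u, by rw [eq_div_iff (RatFunc.algebraMap_ne_zero hv0), h]⟩
  obtain ⟨w, rfl⟩ := hd
  rw [Polynomial.eval_mul] at hv
  exact left_ne_zero_of_mul hv

theorem algebraMap_mem_localRing (x₀ : F) (u : F[X]) :
    algebraMap F[X] (RatFunc F) u ∈ localRing x₀ :=
  mem_localRing_of_mul_eq (u := u) (v := 1) (by simp) (by simp)

theorem X_mem_localRing (x₀ : F) : (RatFunc.X : RatFunc F) ∈ localRing x₀ := by
  rw [← RatFunc.algebraMap_X]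
  exact algebraMap_mem_localRing x₀ _

/-- Evaluation at `x₀`, as a ring homomorphism on the local ring of `x₀`. -/
noncomputable def residueHom (x₀ : F) : localRing x₀ →+* F where
  toFun f := RatFunc.eval (RingHom.id F) x₀ f
  map_one' := by simp
  map_zero' := by simp
  map_mul' f g := RatFunc.eval_mul _ _ f.2 g.2
  map_add' f g := RatFunc.eval_add _ _ f.2 g.2

theorem residueHom_apply (x₀ : F) (f : localRing x₀) :
    residueHom x₀ f = RatFunc.eval (RingHom.id F) x₀ f := rfl

theorem mul_denom_eq_num (f : RatFunc F) :
    f * algebraMap F[X] (RatFunc F) f.denom = algebraMap F[X] (RatFunc F) f.num := by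
  have := RatFunc.algebraMap_ne_zero (RatFunc.denom_ne_zero f)
  nth_rewrite 1 [← RatFunc.num_div_denom f]
  field_simp

theorem isUnit_of_residueHom_ne_zero {x₀ : F} {f : localRing x₀} (hf : residueHom x₀ f ≠ 0) :
    IsUnit f := by
  have hnum : (f : RatFunc F).num.eval x₀ ≠ 0 := by
    intro h
    apply hf
    simp [residueHom_apply, RatFunc.eval, Polynomial.eval₂_id, h]
  have h0 : (f : RatFunc F) ≠ 0 := by intro h; simp [h] at hnum
  have hinv : (f : RatFunc F)⁻¹ ∈ localRing x₀ := by
    refine mem_localRing_of_mul_eq (u := (f : RatFunc F).denom) ?_ hnum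
    rw [← mul_denom_eq_num]
    field_simp
  exact IsUnit.of_mul_eq_one ⟨_, hinv⟩ (Subtype.ext (by simpa using mul_inv_cancel₀ h0))

/-- A function that vanishes at the origin is divisible by the variable in the local ring. -/
theorem X_inv_mul_mem_localRing {f : RatFunc F} (hf : f ∈ localRing 0)
    (h0 : RatFunc.eval (RingHom.id F) 0 f = 0) : RatFunc.X⁻¹ * f ∈ localRing (0 : F) := by
  have hnum : f.num.eval 0 = 0 := by
    rw [RatFunc.eval, Polynomial.eval₂_id, Polynomial.eval₂_id, div_eq_zero_iff] at h0
    exact h0.resolve_right hf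
  obtain ⟨u, hu⟩ : Polynomial.X ∣ f.num := by
    rw [Polynomial.X_dvd_iff, Polynomial.coeff_zero_eq_eval_zero, hnum]
  refine mem_localRing_of_mul_eq (u := u) ?_ hf
  rw [mul_assoc, mul_denom_eq_num, hu, map_mul, RatFunc.algebraMap_X, ← mul_assoc,
    inv_mul_cancel₀ RatFunc.X_ne_zero, one_mul]

/-- The local ring at the origin is separated for the topology given by the powers of the
variable. -/
theorem eq_zero_of_X_pow_dvd {f : RatFunc F}
    (h : ∀ N : ℕ, ∃ g ∈ localRing (0 : F), f = RatFunc.X ^ N * g) : f = 0 := by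
  by_contra hf
  obtain ⟨g, hg, hfg⟩ := h (f.num.natDegree + 1)
  have hnum : f.num ≠ 0 := RatFunc.num_ne_zero hf
  have key : f.num * g.denom = Polynomial.X ^ (f.num.natDegree + 1) * (g.num * f.denom) := by
    apply RatFunc.algebraMap_injective F
    simp only [map_mul, map_pow, RatFunc.algebraMap_X]
    rw [← mul_denom_eq_num f, ← mul_denom_eq_num g]
    nth_rewrite 1 [hfg]
    ring
  have hcop : IsCoprime (Polynomial.X ^ (f.num.natDegree + 1)) g.denom := by
    refine IsCoprime.pow_left ?_
    refine (Polynomial.irreducible_X.coprime_iff_not_dvd).mpr ?_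
    rw [Polynomial.X_dvd_iff, Polynomial.coeff_zero_eq_eval_zero]
    exact hg
  have hdvd := hcop.dvd_of_dvd_mul_right (Dvd.intro _ key.symm)
  have := Polynomial.natDegree_le_of_dvd hdvd hnum
  simp at this

/-! ### Matrices defined at a point -/

theorem isDefinedAt_iff {x₀ : F} {R : Matrix a b (RatFunc F)} :
    IsDefinedAt x₀ R ↔ ∀ i j, R i j ∈ localRing x₀ := Iff.rfl

theorem IsDefinedAt.exists_lift {x₀ : F} {R : Matrix a b (RatFunc F)} (h : IsDefinedAt x₀ R) :
    ∃ R₀ : Matrix a b (localRing x₀), R = R₀.map (localRing x₀).subtype ∧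
      valueAt x₀ R = R₀.map (residueHom x₀) :=
  ⟨Matrix.of fun i j => ⟨R i j, h i j⟩, rfl, rfl⟩

theorem isDefinedAt_map {x₀ : F} (R₀ : Matrix a b (localRing x₀)) :
    IsDefinedAt x₀ (R₀.map (localRing x₀).subtype) := fun i j => (R₀ i j).2

theorem valueAt_map {x₀ : F} (R₀ : Matrix a b (localRing x₀)) :
    valueAt x₀ (R₀.map (localRing x₀).subtype) = R₀.map (residueHom x₀) := rfl

theorem IsDefinedAt.mul [Fintype b] {x₀ : F} {R : Matrix a b (RatFunc F)}
    {S : Matrix b c (RatFunc F)} (hR : IsDefinedAt x₀ R) (hS : IsDefinedAt x₀ S) :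
    IsDefinedAt x₀ (R * S) := fun i j =>
  (localRing x₀).sum_mem fun k _ => (localRing x₀).mul_mem (hR i k) (hS k j)

theorem IsDefinedAt.add {x₀ : F} {R S : Matrix a b (RatFunc F)} (hR : IsDefinedAt x₀ R)
    (hS : IsDefinedAt x₀ S) : IsDefinedAt x₀ (R + S) := fun i j =>
  (localRing x₀).add_mem (hR i j) (hS i j)

theorem IsDefinedAt.sub {x₀ : F} {R S : Matrix a b (RatFunc F)} (hR : IsDefinedAt x₀ R)
    (hS : IsDefinedAt x₀ S) : IsDefinedAt x₀ (R - S) := fun i j =>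
  (localRing x₀).sub_mem (hR i j) (hS i j)

theorem IsDefinedAt.neg {x₀ : F} {R : Matrix a b (RatFunc F)} (hR : IsDefinedAt x₀ R) :
    IsDefinedAt x₀ (-R) := fun i j => (localRing x₀).neg_mem (hR i j)

theorem IsDefinedAt.smul {x₀ : F} {f : RatFunc F} {R : Matrix a b (RatFunc F)}
    (hf : f ∈ localRing x₀) (hR : IsDefinedAt x₀ R) : IsDefinedAt x₀ (f • R) := fun i j =>
  (localRing x₀).mul_mem hf (hR i j)

theorem isDefinedAt_zero (x₀ : F) : IsDefinedAt x₀ (0 : Matrix a b (RatFunc F)) := fun _ _ =>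
  (localRing x₀).zero_mem

theorem isDefinedAt_one [DecidableEq a] (x₀ : F) :
    IsDefinedAt x₀ (1 : Matrix a a (RatFunc F)) := fun i j => by
  rw [Matrix.one_apply]
  split_ifs
  exacts [(localRing x₀).one_mem, (localRing x₀).zero_mem]

theorem isDefinedAt_toRat (x₀ : F) (P : Matrix a b F[X]) : IsDefinedAt x₀ (toRat P) :=
  fun i j => algebraMap_mem_localRing x₀ (P i j)

theorem isDefinedAt_fromBlocks {x₀ : F} {R₁ : Matrix a c (RatFunc F)}
    {R₂ : Matrix a d (RatFunc F)} {R₃ : Matrix b c (RatFunc F)} {R₄ : Matrix b d (RatFunc F)} :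
    IsDefinedAt x₀ (Matrix.fromBlocks R₁ R₂ R₃ R₄) ↔
      IsDefinedAt x₀ R₁ ∧ IsDefinedAt x₀ R₂ ∧ IsDefinedAt x₀ R₃ ∧ IsDefinedAt x₀ R₄ := by
  constructor
  · intro h
    exact ⟨fun i j => h (.inl i) (.inl j), fun i j => h (.inl i) (.inr j),
      fun i j => h (.inr i) (.inl j), fun i j => h (.inr i) (.inr j)⟩
  · rintro ⟨h₁, h₂, h₃, h₄⟩ (i | i) (j | j)
    exacts [h₁ i j, h₂ i j, h₃ i j, h₄ i j]

theorem valueAt_mul [Fintype b] {x₀ : F} {R : Matrix a b (RatFunc F)}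
    {S : Matrix b c (RatFunc F)} (hR : IsDefinedAt x₀ R) (hS : IsDefinedAt x₀ S) :
    valueAt x₀ (R * S) = valueAt x₀ R * valueAt x₀ S := by
  obtain ⟨R₀, rfl, h⟩ := hR.exists_lift
  obtain ⟨S₀, rfl, h'⟩ := hS.exists_lift
  rw [h, h', ← Matrix.map_mul, ← Matrix.map_mul, valueAt_map]

theorem valueAt_add {x₀ : F} {R S : Matrix a b (RatFunc F)} (hR : IsDefinedAt x₀ R)
    (hS : IsDefinedAt x₀ S) : valueAt x₀ (R + S) = valueAt x₀ R + valueAt x₀ S :=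
  Matrix.ext fun i j => RatFunc.eval_add _ _ (hR i j) (hS i j)

theorem valueAt_one [DecidableEq a] (x₀ : F) :
    valueAt x₀ (1 : Matrix a a (RatFunc F)) = 1 := by
  ext i j
  by_cases h : i = j <;> simp [valueAt, Matrix.one_apply, h]

theorem valueAt_toRat (x₀ : F) (P : Matrix a b F[X]) :
    valueAt x₀ (toRat P) = P.map (Polynomial.eval x₀) := by
  ext i j
  simp [valueAt, toRat, RatFunc.eval_algebraMap, Polynomial.eval₂_id]

theorem valueAt_smul_of_eval_eq_zero {x₀ : F} {f : RatFunc F} {R : Matrix a b (RatFunc F)}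
    (hf : f ∈ localRing x₀) (h0 : RatFunc.eval (RingHom.id F) x₀ f = 0) (hR : IsDefinedAt x₀ R) :
    valueAt x₀ (f • R) = 0 := by
  ext i j
  simp only [valueAt, Matrix.map_apply, Matrix.smul_apply, smul_eq_mul, Matrix.zero_apply]
  rw [RatFunc.eval_mul _ _ hf (hR i j), h0, zero_mul]

/-- A matrix regular at a point is invertible over the local ring of the point. -/
theorem IsRegularAt.exists_inverse [Fintype a] [DecidableEq a] {x₀ : F}
    {R : Matrix a a (RatFunc F)} (h : IsRegularAt x₀ R) :
    ∃ S : Matrix a a (RatFunc F), IsDefinedAt x₀ S ∧ R * S = 1 ∧ S * R = 1 := by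
  obtain ⟨hR, hdet⟩ := h
  obtain ⟨R₀, rfl, h'⟩ := hR.exists_lift
  rw [h', ← RingHom.mapMatrix_apply, ← RingHom.map_det] at hdet
  have hu := isUnit_of_residueHom_ne_zero hdet
  refine ⟨R₀⁻¹.map (localRing x₀).subtype, isDefinedAt_map _, ?_, ?_⟩
  · rw [← Matrix.map_mul, Matrix.mul_nonsing_inv _ hu, Matrix.map_one _ (map_zero _) (map_one _)]
  · rw [← Matrix.map_mul, Matrix.nonsing_inv_mul _ hu, Matrix.map_one _ (map_zero _) (map_one _)]

theorem IsDefinedAt.isRegularAt [Fintype a] [DecidableEq a] {x₀ : F}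
    {R S : Matrix a a (RatFunc F)} (hR : IsDefinedAt x₀ R) (hS : IsDefinedAt x₀ S)
    (h : R * S = 1) : IsRegularAt x₀ R := by
  refine ⟨hR, fun h0 => ?_⟩
  have := congrArg Matrix.det (congrArg (valueAt x₀) h)
  rw [valueAt_mul hR hS, Matrix.det_mul, h0, zero_mul, valueAt_one, Matrix.det_one] at this
  exact zero_ne_one this

end LocalRing

/-! ### Equivalence over the local ring of a point -/

section LocalEquiv

variable {F : Type*} [Field F]
variable {a b a' b' a'' b'' s t : Type*} [Fintype a] [Fintype b] [Fintype a'] [Fintype b']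
  [Fintype a''] [Fintype b''] [Fintype s] [Fintype t]
  [DecidableEq a] [DecidableEq b] [DecidableEq a'] [DecidableEq b']
  [DecidableEq a''] [DecidableEq b''] [DecidableEq s] [DecidableEq t]

/-- The rational matrices `G` and `H` are equivalent over the local ring of `x₀`: `P * G = H * Q`
with `P` and `Q` invertible over that ring. The index types of `G` and `H` may differ, so that
permutations of rows and columns and changes of index types are covered; invertibility is
therefore expressed by two-sided inverses `P'` and `Q'`. -/
def LocalEquiv (x₀ : F) (G : Matrix a b (RatFunc F)) (H : Matrix a' b' (RatFunc F)) : Prop :=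
  ∃ (P : Matrix a' a (RatFunc F)) (P' : Matrix a a' (RatFunc F))
    (Q : Matrix b' b (RatFunc F)) (Q' : Matrix b b' (RatFunc F)),
    IsDefinedAt x₀ P ∧ IsDefinedAt x₀ P' ∧ IsDefinedAt x₀ Q ∧ IsDefinedAt x₀ Q' ∧
      P * P' = 1 ∧ P' * P = 1 ∧ Q * Q' = 1 ∧ Q' * Q = 1 ∧ P * G = H * Q

/-- The block diagonal matrix `diag (G, 1)`, with identity block indexed by `s`. -/
noncomputable abbrev extendOne (s : Type*) [DecidableEq s] (G : Matrix a b (RatFunc F)) :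
    Matrix (a ⊕ s) (b ⊕ s) (RatFunc F) := Matrix.fromBlocks G 0 0 1

variable {x₀ : F} {G : Matrix a b (RatFunc F)} {H : Matrix a' b' (RatFunc F)}
  {K : Matrix a'' b'' (RatFunc F)}

theorem LocalEquiv.symm (h : LocalEquiv x₀ G H) : LocalEquiv x₀ H G := by
  obtain ⟨P, P', Q, Q', hP, hP', hQ, hQ', e₁, e₂, e₃, e₄, e⟩ := h
  refine ⟨P', P, Q', Q, hP', hP, hQ', hQ, e₂, e₁, e₄, e₃, ?_⟩
  calc P' * H = P' * (H * Q) * Q' := by rw [Matrix.mul_assoc, Matrix.mul_assoc, e₃, Matrix.mul_one]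
    _ = G * Q' := by rw [← e, ← Matrix.mul_assoc, e₂, Matrix.one_mul]

theorem LocalEquiv.trans (h : LocalEquiv x₀ G H) (h' : LocalEquiv x₀ H K) :
    LocalEquiv x₀ G K := by
  obtain ⟨P, P', Q, Q', hP, hP', hQ, hQ', e₁, e₂, e₃, e₄, e⟩ := h
  obtain ⟨R, R', S, S', hR, hR', hS, hS', f₁, f₂, f₃, f₄, f⟩ := h'
  refine ⟨R * P, P' * R', S * Q, Q' * S', hR.mul hP, hP'.mul hR', hS.mul hQ, hQ'.mul hS',
    ?_, ?_, ?_, ?_, ?_⟩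
  · rw [Matrix.mul_assoc, ← Matrix.mul_assoc P, e₁, Matrix.one_mul, f₁]
  · rw [Matrix.mul_assoc, ← Matrix.mul_assoc R', f₂, Matrix.one_mul, e₂]
  · rw [Matrix.mul_assoc, ← Matrix.mul_assoc Q, e₃, Matrix.one_mul, f₃]
  · rw [Matrix.mul_assoc, ← Matrix.mul_assoc S', f₄, Matrix.one_mul, e₄]
  · rw [Matrix.mul_assoc, e, ← Matrix.mul_assoc, f, Matrix.mul_assoc]

theorem LocalEquiv.smul (h : LocalEquiv x₀ G H) (f : RatFunc F) :
    LocalEquiv x₀ (f • G) (f • H) := by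
  obtain ⟨P, P', Q, Q', hP, hP', hQ, hQ', e₁, e₂, e₃, e₄, e⟩ := h
  exact ⟨P, P', Q, Q', hP, hP', hQ, hQ', e₁, e₂, e₃, e₄, by
    rw [Matrix.mul_smul, e, Matrix.smul_mul]⟩

theorem localEquiv_submatrix (x₀ : F) (G : Matrix a b (RatFunc F)) (e : a' ≃ a) (f : b' ≃ b) :
    LocalEquiv x₀ G (G.submatrix e f) := by
  refine ⟨(1 : Matrix a a (RatFunc F)).submatrix e id, (1 : Matrix a a (RatFunc F)).submatrix id e,
    (1 : Matrix b b (RatFunc F)).submatrix f id, (1 : Matrix b b (RatFunc F)).submatrix id f,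
    fun i j => isDefinedAt_one x₀ (e i) j, fun i j => isDefinedAt_one x₀ i (e j),
    fun i j => isDefinedAt_one x₀ (f i) j, fun i j => isDefinedAt_one x₀ i (f j),
    ?_, ?_, ?_, ?_, ?_⟩
  · rw [← Matrix.submatrix_mul _ _ _ id _ Function.bijective_id]
    simp
  · rw [Matrix.submatrix_mul_equiv _ _ id e id]
    simp
  · rw [← Matrix.submatrix_mul _ _ _ id _ Function.bijective_id]
    simp
  · rw [Matrix.submatrix_mul_equiv _ _ id f id]
    simp
  · calc (1 : Matrix a a (RatFunc F)).submatrix e id * G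
        = ((1 : Matrix a a (RatFunc F)) * G).submatrix e id :=
          (Matrix.submatrix_mul _ _ _ id _ Function.bijective_id).symm
      _ = (G * (1 : Matrix b b (RatFunc F))).submatrix e id := by
          rw [Matrix.one_mul, Matrix.mul_one]
      _ = _ := Matrix.submatrix_mul _ _ _ f _ f.bijective

theorem LocalEquiv.extendOne (h : LocalEquiv x₀ G H) (s : Type*) [Fintype s] [DecidableEq s] :
    LocalEquiv x₀ (extendOne s G) (extendOne s H) := by
  obtain ⟨P, P', Q, Q', hP, hP', hQ, hQ', e₁, e₂, e₃, e₄, e⟩ := h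
  refine ⟨RatLin.extendOne s P, RatLin.extendOne s P', RatLin.extendOne s Q,
    RatLin.extendOne s Q', ?_, ?_, ?_, ?_, ?_, ?_, ?_, ?_, ?_⟩
  any_goals
    rw [isDefinedAt_fromBlocks]
    exact ⟨by assumption, isDefinedAt_zero x₀, isDefinedAt_zero x₀, isDefinedAt_one x₀⟩
  all_goals simp [Matrix.fromBlocks_multiply, *]

/-- Iterated extensions may be merged and reordered along an equivalence of the index types. -/
theorem localEquiv_extendOne_extendOne {u : Type*} [Fintype u] [DecidableEq u] (x₀ : F)
    (G : Matrix a b (RatFunc F)) (e : u ≃ s ⊕ t) :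
    LocalEquiv x₀ (extendOne t (extendOne s G)) (extendOne u G) := by
  convert localEquiv_submatrix x₀ (extendOne t (extendOne s G))
    ((Equiv.sumCongr (Equiv.refl a) e).trans (Equiv.sumAssoc a s t).symm)
    ((Equiv.sumCongr (Equiv.refl b) e).trans (Equiv.sumAssoc b s t).symm) using 1
  ext (i | i) (j | j)
  · simp
  · rcases h : e j with k | k <;> simp [h]
  · rcases h : e i with k | k <;> simp [h]
  · have hij : i = j ↔ e i = e j := e.injective.eq_iff.symm
    rcases h : e i with k | k <;> rcases h' : e j with l | l <;>
      simp [h, h', Matrix.one_apply, hij]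

theorem localEquiv_extendOne_of_isEmpty [IsEmpty s] (x₀ : F) (G : Matrix a b (RatFunc F)) :
    LocalEquiv x₀ G (extendOne s G) := by
  convert localEquiv_submatrix x₀ G (Equiv.sumEmpty a s) (Equiv.sumEmpty b s) using 1
  ext (i | i) (j | j)
  · simp
  · exact isEmptyElim j
  · exact isEmptyElim i
  · exact isEmptyElim i

/-! ### Cancellation of identity blocks -/

/-- If the lower right block of the transformation matrix is invertible over the local ring, the
Schur complement of that block gives an equivalence of the remaining blocks. -/
theorem localEquiv_of_corner {P : Matrix (a' ⊕ s) (a ⊕ s) (RatFunc F)}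
    {P' : Matrix (a ⊕ s) (a' ⊕ s) (RatFunc F)} {Q : Matrix (b' ⊕ s) (b ⊕ s) (RatFunc F)}
    {Q' : Matrix (b ⊕ s) (b' ⊕ s) (RatFunc F)}
    (hP : IsDefinedAt x₀ P) (hP' : IsDefinedAt x₀ P') (hQ : IsDefinedAt x₀ Q)
    (hQ' : IsDefinedAt x₀ Q') (e₁ : P * P' = 1) (e₂ : P' * P = 1) (e₃ : Q * Q' = 1)
    (e₄ : Q' * Q = 1) (e : P * extendOne s G = extendOne s H * Q)
    (hreg : IsRegularAt x₀ P.toBlocks₂₂) : LocalEquiv x₀ G H := by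
  obtain ⟨W, hW, hVW, hWV⟩ := hreg.exists_inverse
  obtain ⟨P₁, P₂, P₃, V, rfl⟩ : ∃ P₁ P₂ P₃ V, P = Matrix.fromBlocks P₁ P₂ P₃ V :=
    ⟨_, _, _, _, (Matrix.fromBlocks_toBlocks P).symm⟩
  obtain ⟨Q₁, Q₂, Q₃, V', rfl⟩ : ∃ Q₁ Q₂ Q₃ V', Q = Matrix.fromBlocks Q₁ Q₂ Q₃ V' :=
    ⟨_, _, _, _, (Matrix.fromBlocks_toBlocks Q).symm⟩
  obtain ⟨P₁', P₂', P₃', P₄', rfl⟩ : ∃ P₁ P₂ P₃ V, P' = Matrix.fromBlocks P₁ P₂ P₃ V :=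
    ⟨_, _, _, _, (Matrix.fromBlocks_toBlocks P').symm⟩
  obtain ⟨Q₁', Q₂', Q₃', Q₄', rfl⟩ : ∃ Q₁ Q₂ Q₃ V, Q' = Matrix.fromBlocks Q₁ Q₂ Q₃ V :=
    ⟨_, _, _, _, (Matrix.fromBlocks_toBlocks Q').symm⟩
  rw [isDefinedAt_fromBlocks] at hP hQ hP' hQ'
  rw [Matrix.fromBlocks_multiply, ← Matrix.fromBlocks_one, Matrix.fromBlocks_inj] at e₁ e₂ e₃ e₄
  simp only [extendOne, Matrix.fromBlocks_multiply, Matrix.mul_zero, Matrix.zero_mul,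
    Matrix.mul_one, Matrix.one_mul, add_zero, zero_add, Matrix.fromBlocks_inj] at e
  rw [Matrix.toBlocks_fromBlocks₂₂] at hVW hWV
  obtain ⟨hP₁, hP₂, hP₃, -⟩ := hP
  obtain ⟨hQ₁, hQ₂, hQ₃, -⟩ := hQ
  obtain ⟨f₁, f₂, f₃, rfl⟩ := e
  refine ⟨P₁ - P₂ * W * P₃, P₁', Q₁ - Q₂ * W * Q₃, Q₁', hP₁.sub ((hP₂.mul hW).mul hP₃), hP'.1,
    hQ₁.sub ((hQ₂.mul hW).mul hQ₃), hQ'.1, ?_, ?_, ?_, ?_, ?_⟩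
  · have h : P₃ * P₁' = -(V * P₃') := eq_neg_of_add_eq_zero_left e₁.2.2.1
    rw [Matrix.sub_mul, Matrix.mul_assoc _ P₃, h, Matrix.mul_neg, Matrix.mul_assoc P₂,
      ← Matrix.mul_assoc W, hWV, Matrix.one_mul, sub_neg_eq_add, e₁.1]
  · have h : P₁' * P₂ = -(P₂' * V) := eq_neg_of_add_eq_zero_left e₂.2.1
    rw [Matrix.mul_sub, ← Matrix.mul_assoc, ← Matrix.mul_assoc, h, Matrix.neg_mul,
      Matrix.mul_assoc P₂', hVW, Matrix.mul_one, Matrix.neg_mul, sub_neg_eq_add, e₂.1]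
  · have h : Q₃ * Q₁' = -(V * Q₃') := eq_neg_of_add_eq_zero_left e₃.2.2.1
    rw [Matrix.sub_mul, Matrix.mul_assoc _ Q₃, h, Matrix.mul_neg, Matrix.mul_assoc Q₂,
      ← Matrix.mul_assoc W, hWV, Matrix.one_mul, sub_neg_eq_add, e₃.1]
  · have h : Q₁' * Q₂ = -(Q₂' * V) := eq_neg_of_add_eq_zero_left e₄.2.1
    rw [Matrix.mul_sub, ← Matrix.mul_assoc, ← Matrix.mul_assoc, h, Matrix.neg_mul,
      Matrix.mul_assoc Q₂', hVW, Matrix.mul_one, Matrix.neg_mul, sub_neg_eq_add, e₄.1]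
  · rw [Matrix.sub_mul, Matrix.mul_sub, f₁, Matrix.mul_assoc _ P₃, f₃, f₂]
    simp only [Matrix.mul_assoc]

/-- The unipotent block matrix `[1, Z; 0, 1]`. -/
noncomputable def unipotent (Z : Matrix a s (RatFunc F)) : Matrix (a ⊕ s) (a ⊕ s) (RatFunc F) :=
  Matrix.fromBlocks 1 Z 0 1

theorem isDefinedAt_unipotent {c e : Type*} [DecidableEq c] [DecidableEq e]
    {Z : Matrix c e (RatFunc F)} (hZ : IsDefinedAt x₀ Z) :
    IsDefinedAt x₀ (unipotent Z) :=
  isDefinedAt_fromBlocks.2 ⟨isDefinedAt_one x₀, hZ, isDefinedAt_zero x₀, isDefinedAt_one x₀⟩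

theorem unipotent_mul_unipotent_neg (Z : Matrix a s (RatFunc F)) :
    unipotent Z * unipotent (-Z) = 1 := by
  simp [unipotent, Matrix.fromBlocks_multiply]

theorem unipotent_neg_mul_unipotent (Z : Matrix a s (RatFunc F)) :
    unipotent (-Z) * unipotent Z = 1 := by
  simp [unipotent, Matrix.fromBlocks_multiply]

/-- Cancellation of a `1 × 1` identity block. When the corner entry `v` of the transformation
matrices vanishes at the point, multiplying them by unipotent automorphisms of `diag (G, 1)` changes
that entry to `1 - v * v' + v`, where `v'` is the corner entry of the inverse; the new entry is a
unit of the local ring. -/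
theorem LocalEquiv.cancel_unit
    (h : LocalEquiv x₀ (RatLin.extendOne Unit G) (RatLin.extendOne Unit H)) :
    LocalEquiv x₀ G H := by
  obtain ⟨P, P', Q, Q', hP, hP', hQ, hQ', e₁, e₂, e₃, e₄, e⟩ := h
  by_cases hreg : IsRegularAt x₀ P.toBlocks₂₂
  · exact localEquiv_of_corner hP hP' hQ hQ' e₁ e₂ e₃ e₄ e hreg
  have e' : P' * RatLin.extendOne Unit H = RatLin.extendOne Unit G * Q' := by
    calc P' * RatLin.extendOne Unit H
        = P' * (RatLin.extendOne Unit H * Q) * Q' := by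
          rw [Matrix.mul_assoc, Matrix.mul_assoc, e₃, Matrix.mul_one]
      _ = RatLin.extendOne Unit G * Q' := by rw [← e, ← Matrix.mul_assoc, e₂, Matrix.one_mul]
  set X := P'.toBlocks₁₂ with hXdef
  set Y := Q'.toBlocks₁₂ with hYdef
  have hX : IsDefinedAt x₀ X := fun i j => hP' _ _
  have hY : IsDefinedAt x₀ Y := fun i j => hQ' _ _
  have hXY : X = G * Y := by
    have := congrArg Matrix.toBlocks₁₂ e'
    rw [← Matrix.fromBlocks_toBlocks P', ← Matrix.fromBlocks_toBlocks Q'] at this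
    simpa [Matrix.fromBlocks_multiply] using this
  have hcorner : (P * unipotent X).toBlocks₂₂
      = 1 - P.toBlocks₂₂ * P'.toBlocks₂₂ + P.toBlocks₂₂ := by
    have h₂₂ := congrArg Matrix.toBlocks₂₂ e₁
    rw [← Matrix.fromBlocks_toBlocks P, ← Matrix.fromBlocks_toBlocks P',
      Matrix.fromBlocks_multiply, Matrix.toBlocks_fromBlocks₂₂, ← Matrix.fromBlocks_one,
      Matrix.toBlocks_fromBlocks₂₂, ← hXdef] at h₂₂
    rw [← Matrix.fromBlocks_toBlocks P, unipotent, Matrix.fromBlocks_multiply,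
      Matrix.toBlocks_fromBlocks₂₂, Matrix.toBlocks_fromBlocks₂₂, Matrix.mul_one, ← h₂₂,
      add_sub_cancel_right]
  have hdef : IsDefinedAt x₀ P.toBlocks₂₂ := fun i j => hP _ _
  have hdef' : IsDefinedAt x₀ P'.toBlocks₂₂ := fun i j => hP' _ _
  have hval : valueAt x₀ P.toBlocks₂₂ = 0 := by
    ext i j
    by_contra hne
    refine hreg ⟨hdef, ?_⟩
    rw [Matrix.det_unique]
    exact hne
  refine localEquiv_of_corner (P := P * unipotent X) (P' := unipotent (-X) * P')
    (Q := Q * unipotent Y) (Q' := unipotent (-Y) * Q') (hP.mul (isDefinedAt_unipotent hX))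
    ((isDefinedAt_unipotent hX.neg).mul hP') (hQ.mul (isDefinedAt_unipotent hY))
    ((isDefinedAt_unipotent hY.neg).mul hQ') ?_ ?_ ?_ ?_ ?_ ?_
  · rw [Matrix.mul_assoc, ← Matrix.mul_assoc _ _ P', unipotent_mul_unipotent_neg, Matrix.one_mul,
      e₁]
  · rw [Matrix.mul_assoc, ← Matrix.mul_assoc P', e₂, Matrix.one_mul, unipotent_neg_mul_unipotent]
  · rw [Matrix.mul_assoc, ← Matrix.mul_assoc _ _ Q', unipotent_mul_unipotent_neg, Matrix.one_mul,
      e₃]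
  · rw [Matrix.mul_assoc, ← Matrix.mul_assoc Q', e₄, Matrix.one_mul, unipotent_neg_mul_unipotent]
  · have hcomm : unipotent X * RatLin.extendOne Unit G
        = RatLin.extendOne Unit G * unipotent Y := by
      simp [unipotent, Matrix.fromBlocks_multiply, hXY]
    rw [Matrix.mul_assoc, hcomm, ← Matrix.mul_assoc, e, Matrix.mul_assoc]
  · rw [hcorner]
    have h₁ := (isDefinedAt_one x₀).sub (hdef.mul hdef')
    refine ⟨h₁.add hdef, ?_⟩
    have h₂ : valueAt x₀ (1 - P.toBlocks₂₂ * P'.toBlocks₂₂) = 1 := by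
      have h₃ := valueAt_add h₁ (hdef.mul hdef')
      rw [sub_add_cancel, valueAt_mul hdef hdef', hval, Matrix.zero_mul, add_zero,
        valueAt_one] at h₃
      exact h₃.symm
    rw [valueAt_add h₁ hdef, h₂, hval, add_zero, Matrix.det_one]
    exact one_ne_zero

/-- Cancellation of identity blocks of arbitrary size. -/
theorem LocalEquiv.cancel {s : ℕ}
    (h : LocalEquiv x₀ (RatLin.extendOne (Fin s) G) (RatLin.extendOne (Fin s) H)) :
    LocalEquiv x₀ G H := by
  induction s with
  | zero =>
    exact ((localEquiv_extendOne_of_isEmpty x₀ G).trans h).trans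
      (localEquiv_extendOne_of_isEmpty x₀ H).symm
  | succ s ih =>
    have e : Fin (s + 1) ≃ Fin s ⊕ Unit := by
      exact (Fintype.equivFinOfCardEq (by simp)).symm
    exact ih ((((localEquiv_extendOne_extendOne x₀ G e).trans h).trans
      (localEquiv_extendOne_extendOne x₀ H e).symm).cancel_unit)

/-! ### Values of equivalent matrices -/

/-- If `diag (M, 1_s)` and `diag (N, 1_t)` are equivalent and `N` is defined, then `M` is. -/
theorem LocalEquiv.isDefinedAt
    (h : LocalEquiv x₀ (RatLin.extendOne s G) (RatLin.extendOne t H)) (hH : IsDefinedAt x₀ H) :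
    IsDefinedAt x₀ G := by
  obtain ⟨P, P', Q, Q', hP, hP', hQ, hQ', e₁, e₂, e₃, e₄, e⟩ := h
  have hGe : RatLin.extendOne s G = P' * (RatLin.extendOne t H * Q) := by
    rw [← e, ← Matrix.mul_assoc, e₂, Matrix.one_mul]
  have : IsDefinedAt x₀ (RatLin.extendOne s G) := by
    rw [hGe]
    exact hP'.mul ((isDefinedAt_fromBlocks.2
      ⟨hH, isDefinedAt_zero x₀, isDefinedAt_zero x₀, isDefinedAt_one x₀⟩).mul hQ)
  exact (isDefinedAt_fromBlocks.1 this).1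

/-- If `N` vanishes at the point, then the value of `diag (N, 1_t)` there has rank `t`, which bounds
the size of any identity block of an equivalent matrix. -/
theorem LocalEquiv.card_le
    (h : LocalEquiv x₀ (RatLin.extendOne s G) (RatLin.extendOne t H)) (hH : IsDefinedAt x₀ H)
    (h0 : valueAt x₀ H = 0) : Fintype.card s ≤ Fintype.card t := by
  obtain ⟨P, P', Q, Q', hP, hP', hQ, hQ', e₁, e₂, e₃, e₄, e⟩ := h
  have hGe : RatLin.extendOne s G = P' * (RatLin.extendOne t H * Q) := by
    rw [← e, ← Matrix.mul_assoc, e₂, Matrix.one_mul]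
  have h₂₂ := congrArg Matrix.toBlocks₂₂ hGe
  rw [← Matrix.fromBlocks_toBlocks P', ← Matrix.fromBlocks_toBlocks Q] at h₂₂
  simp only [RatLin.extendOne, Matrix.fromBlocks_multiply, Matrix.toBlocks_fromBlocks₂₂,
    Matrix.zero_mul, Matrix.one_mul, add_zero, zero_add] at h₂₂
  have d₁ : IsDefinedAt x₀ P'.toBlocks₂₁ := fun i j => hP' _ _
  have d₂ : IsDefinedAt x₀ P'.toBlocks₂₂ := fun i j => hP' _ _
  have d₃ : IsDefinedAt x₀ Q.toBlocks₁₂ := fun i j => hQ _ _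
  have d₄ : IsDefinedAt x₀ Q.toBlocks₂₂ := fun i j => hQ _ _
  have hv := congrArg (valueAt x₀) h₂₂
  rw [valueAt_one, valueAt_add (d₁.mul (hH.mul d₃)) (d₂.mul d₄), valueAt_mul d₁ (hH.mul d₃),
    valueAt_mul hH d₃, h0, Matrix.zero_mul, Matrix.mul_zero, zero_add, valueAt_mul d₂ d₄] at hv
  calc Fintype.card s = (1 : Matrix s s F).rank := Matrix.rank_one.symm
    _ ≤ (valueAt x₀ P'.toBlocks₂₂).rank := by rw [hv]; exact Matrix.rank_mul_le_left _ _
    _ ≤ Fintype.card t := Matrix.rank_le_card_width _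

theorem exists_eq_X_pow_smul_of_localEquiv {H : Matrix a b (RatFunc F)}
    (h : LocalEquiv 0 H ((RatFunc.X : RatFunc F) • H)) (hH : IsDefinedAt 0 H)
    (N : ℕ) : ∃ M : Matrix a b (RatFunc F), IsDefinedAt 0 M ∧
      H = (RatFunc.X : RatFunc F) ^ N • M := by
  obtain ⟨P, P', Q, Q', hP, hP', hQ, hQ', e₁, e₂, e₃, e₄, e⟩ := h
  have hHe : H = (RatFunc.X : RatFunc F) • (P' * (H * Q)) := by
    rw [← Matrix.mul_smul, ← Matrix.smul_mul, ← e, ← Matrix.mul_assoc, e₂, Matrix.one_mul]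
  induction N with
  | zero => exact ⟨H, hH, by simp⟩
  | succ N ih =>
    obtain ⟨M, hM, hHM⟩ := ih
    refine ⟨P' * (M * Q), hP'.mul (hM.mul hQ), ?_⟩
    nth_rewrite 1 [hHe]
    nth_rewrite 1 [hHM]
    rw [Matrix.smul_mul, Matrix.mul_smul, smul_smul, pow_succ']

/-- Multiplication by the variable raises all elementary divisors of a nonzero matrix at the origin,
so only the zero matrix is equivalent to its multiple by the variable. -/
theorem eq_zero_of_localEquiv_X_smul {H : Matrix a b (RatFunc F)}
    (h : LocalEquiv 0 H ((RatFunc.X : RatFunc F) • H)) (hH : IsDefinedAt 0 H) : H = 0 := by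
  ext1 i j
  refine eq_zero_of_X_pow_dvd fun N => ?_
  obtain ⟨M, hM, hHM⟩ := exists_eq_X_pow_smul_of_localEquiv h hH N
  exact ⟨M i j, hM i j, by nth_rewrite 1 [hHM]; rfl⟩

end LocalEquiv

/-! ### Extension equivalence in terms of the local ring -/

section ExtEquiv

variable {F : Type*} [Field F] {p m q r : ℕ}

theorem localEquiv_diagOne (x₀ : F) (G : Matrix (Fin p) (Fin m) (RatFunc F)) (s : ℕ) :
    LocalEquiv x₀ (diagOne G s) (extendOne (Fin s) G) :=
  (localEquiv_submatrix x₀ (extendOne (Fin s) G) finSumFinEquiv.symm finSumFinEquiv.symm).symm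

theorem ExtEquivAt.exists_localEquiv {x₀ : F} {G : Matrix (Fin p) (Fin m) (RatFunc F)}
    {H : Matrix (Fin q) (Fin r) (RatFunc F)} (h : ExtEquivAt x₀ G H) :
    ∃ s₁ s₂ : ℕ, p + s₁ = q + s₂ ∧ m + s₁ = r + s₂ ∧
      LocalEquiv x₀ (extendOne (Fin s₁) G) (extendOne (Fin s₂) H) := by
  obtain ⟨s₁, s₂, hrow, hcol, R₁, R₂, h₁, h₂, e⟩ := h
  refine ⟨s₁, s₂, hrow, hcol, ?_⟩
  obtain ⟨S₁, hS₁, e₁, e₁'⟩ := h₁.exists_inverse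
  obtain ⟨S₂, hS₂, e₂, e₂'⟩ := h₂.exists_inverse
  have hmid : LocalEquiv x₀ (diagOne G s₁)
      ((diagOne H s₂).submatrix (Fin.cast hrow) (Fin.cast hcol)) := by
    refine ⟨R₁, S₁, S₂, R₂, h₁.1, hS₁, hS₂, h₂.1, e₁, e₁', e₂', e₂, ?_⟩
    rw [← e, Matrix.mul_assoc _ R₂, e₂, Matrix.mul_one]
  exact (((localEquiv_diagOne x₀ G s₁).symm.trans hmid).trans
    (localEquiv_submatrix x₀ (diagOne H s₂) (finCongr hrow) (finCongr hcol)).symm).trans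
    (localEquiv_diagOne x₀ H s₂)

theorem LocalEquiv.extEquivAt {x₀ : F} {G H : Matrix (Fin p) (Fin m) (RatFunc F)}
    (h : LocalEquiv x₀ G H) : ExtEquivAt x₀ G H := by
  obtain ⟨P, P', Q, Q', hP, hP', hQ, hQ', e₁, e₂, e₃, e₄, e⟩ :=
    ((localEquiv_diagOne x₀ G 0).trans (h.extendOne (Fin 0))).trans (localEquiv_diagOne x₀ H 0).symm
  refine ⟨0, 0, rfl, rfl, P, Q', hP.isRegularAt hP' e₁, hQ'.isRegularAt hQ e₄, ?_⟩
  rw [e, Matrix.mul_assoc, e₃, Matrix.mul_one]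
  rfl

end ExtEquiv

/-! ### The substitution of the reciprocal of the variable -/

section Reversal

variable {F : Type*} [Field F] {a b : Type*}

theorem eval₂_X_inv_mul_pow (P : F[X]) {N : ℕ} (hN : P.natDegree ≤ N) :
    P.eval₂ RatFunc.C (RatFunc.X)⁻¹ * RatFunc.X ^ N
      = algebraMap F[X] (RatFunc F) (P.reflect N) := by
  have hX : (RatFunc.X : RatFunc F)⁻¹ ≠ 0 := inv_ne_zero RatFunc.X_ne_zero
  let _ : Invertible (RatFunc.X : RatFunc F)⁻¹ := invertibleOfNonzero hX
  have h := Polynomial.eval₂_reflect_mul_pow RatFunc.C (RatFunc.X : RatFunc F)⁻¹ N P hN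
  rw [invOf_eq_inv, inv_inv] at h
  rw [← h, mul_assoc, ← mul_pow, inv_mul_cancel₀ RatFunc.X_ne_zero, one_pow, mul_one]
  have : (algebraMap F[X] (RatFunc F)) = Polynomial.eval₂RingHom RatFunc.C RatFunc.X := by
    refine Polynomial.ringHom_ext (fun c => ?_) ?_ <;> simp
  rw [this]
  rfl

theorem eval₂_X_inv_ne_zero {P : F[X]} (hP : P ≠ 0) :
    P.eval₂ RatFunc.C (RatFunc.X : RatFunc F)⁻¹ ≠ 0 := by
  intro h
  have := eval₂_X_inv_mul_pow P le_rfl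
  rw [h, zero_mul, eq_comm, map_eq_zero_iff _ (RatFunc.algebraMap_injective F),
    Polynomial.reflect_eq_zero_iff] at this
  exact hP this

/-- The substitution `f(λ) ↦ f(1 / λ)`, as a ring homomorphism. -/
noncomputable def recip : RatFunc F →+* RatFunc F where
  toFun f := f.eval RatFunc.C (RatFunc.X)⁻¹
  map_one' := by simp
  map_zero' := by simp
  map_mul' f g := RatFunc.eval_mul _ _ (eval₂_X_inv_ne_zero f.denom_ne_zero)
    (eval₂_X_inv_ne_zero g.denom_ne_zero)
  map_add' f g := RatFunc.eval_add _ _ (eval₂_X_inv_ne_zero f.denom_ne_zero)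
    (eval₂_X_inv_ne_zero g.denom_ne_zero)

theorem recip_apply (f : RatFunc F) : recip f = f.eval RatFunc.C (RatFunc.X)⁻¹ := rfl

theorem recip_algebraMap (P : F[X]) :
    recip (algebraMap F[X] (RatFunc F) P) = P.eval₂ RatFunc.C (RatFunc.X)⁻¹ := by
  simp [recip_apply, RatFunc.eval_algebraMap]

theorem revGrade_eq_smul (g : ℤ) (G : Matrix a b (RatFunc F)) :
    revGrade g G = (RatFunc.X : RatFunc F) ^ g • G.map recip := rfl

theorem revGrade_eq_zpow_smul_revGrade (g k : ℤ) (G : Matrix a b (RatFunc F)) :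
    revGrade g G = (RatFunc.X : RatFunc F) ^ (g - k) • revGrade k G := by
  rw [revGrade_eq_smul, revGrade_eq_smul, smul_smul, ← zpow_add₀ RatFunc.X_ne_zero, sub_add_cancel]

/-! ### The degree of the polynomial part -/

/-- A proper rational function is defined at infinity. -/
theorem recip_mem_localRing {f : RatFunc F} (hf : f.num.natDegree ≤ f.denom.natDegree) :
    recip f ∈ localRing (0 : F) := by
  refine mem_localRing_of_mul_eq (u := f.num.reflect f.denom.natDegree)
    (v := f.denom.reflect f.denom.natDegree) ?_ ?_
  · rw [← eval₂_X_inv_mul_pow _ hf, ← eval₂_X_inv_mul_pow _ le_rfl, ← mul_assoc]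
    congr 1
    rw [← recip_algebraMap, ← recip_algebraMap, ← mul_denom_eq_num, map_mul]
  · rw [← Polynomial.coeff_zero_eq_eval_zero, ← Polynomial.reverse,
      Polynomial.coeff_zero_reverse]
    simpa using f.denom_ne_zero

theorem X_pow_mul_recip_algebraMap_mem_iff {P : F[X]} {d : ℕ} :
    RatFunc.X ^ d * recip (algebraMap F[X] (RatFunc F) P) ∈ localRing (0 : F) ↔
      P.natDegree ≤ d := by
  rw [recip_algebraMap]
  constructor
  · intro h
    by_contra! hlt
    obtain ⟨k, hk⟩ := Nat.exists_eq_add_of_lt hlt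
    have hP : P ≠ 0 := by rintro rfl; simp at hlt
    have e := eval₂_X_inv_mul_pow P le_rfl
    have e' : algebraMap F[X] (RatFunc F) (P.reflect P.natDegree)
        = RatFunc.X * (RatFunc.X ^ k * (RatFunc.X ^ d * P.eval₂ RatFunc.C (RatFunc.X)⁻¹)) := by
      rw [← e, hk]
      ring
    have h' := (localRing (0 : F)).mul_mem ((localRing (0 : F)).pow_mem (X_mem_localRing 0) k) h
    have hev := congrArg (RatFunc.eval (RingHom.id F) 0) e'
    rw [RatFunc.eval_mul _ _ (X_mem_localRing 0) h', RatFunc.eval_X, zero_mul,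
      RatFunc.eval_algebraMap, Polynomial.eval₂_id, Algebra.algebraMap_self, RingHom.id_apply,
      ← Polynomial.coeff_zero_eq_eval_zero, ← Polynomial.reverse,
      Polynomial.coeff_zero_reverse, Polynomial.leadingCoeff_eq_zero] at hev
    exact hP hev
  · intro h
    rw [mul_comm, eval₂_X_inv_mul_pow P h]
    exact algebraMap_mem_localRing 0 _

theorem matDegree_le_iff [Fintype a] [Fintype b] {P : Matrix a b F[X]} {d : ℕ} :
    matDegree P ≤ d ↔ ∀ i j, (P i j).natDegree ≤ d := by
  simp [matDegree, Finset.sup_le_iff]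

/-- The degree of the polynomial part is the smallest natural number `d` such that the reversal of
grade `d` is defined at the origin. -/
theorem polyGrade_le_iff [Fintype a] [Fintype b] {G : Matrix a b (RatFunc F)} {d : ℕ} :
    polyGrade G ≤ d ↔ IsDefinedAt 0 (revGrade (d : ℤ) G) := by
  rw [polyGrade, matDegree_le_iff, isDefinedAt_iff]
  refine forall_congr' fun i => forall_congr' fun j => ?_
  have hs := isStrictlyProper_sub_polyPart G i j
  have hG : G i j = algebraMap F[X] (RatFunc F) (polyPart G i j)
      + (G - toRat (polyPart G)) i j := by simp [toRat]
  have hmem : RatFunc.X ^ d * recip ((G - toRat (polyPart G)) i j) ∈ localRing (0 : F) :=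
    (localRing (0 : F)).mul_mem ((localRing (0 : F)).pow_mem (X_mem_localRing 0) d)
      (recip_mem_localRing (Polynomial.natDegree_le_natDegree hs.le))
  have hrev : revGrade (d : ℤ) G i j = RatFunc.X ^ d * recip (G i j) := by
    rw [revGrade_eq_smul, zpow_natCast]
    rfl
  rw [hrev, hG, map_add, mul_add, add_mem_cancel_right (H := localRing (0 : F)) hmem,
    X_pow_mul_recip_algebraMap_mem_iff]

theorem polyGrade_toRat [Fintype a] [Fintype b] (P : Matrix a b F[X]) :
    polyGrade (toRat P) = matDegree P := by
  rw [polyGrade, polyPart_eq (toRat P) 0 P (by simp) (fun i j => by simp)]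

end Reversal

/-! ### Pencils and their reversals -/

section Pencil

variable {F : Type*} [Field F] {a b : Type*}

theorem pencil_map_eval (M₁ M₀ : Matrix a b F) (x₀ : F) :
    (pencil M₁ M₀).map (Polynomial.eval x₀) = x₀ • M₁ + M₀ := by
  ext i j
  simp [pencil, mul_comm x₀]

theorem natDegree_pencil_le (M₁ M₀ : Matrix a b F) (i : a) (j : b) :
    (pencil M₁ M₀ i j).natDegree ≤ 1 := by
  simpa only [pencil, Matrix.add_apply, Matrix.map_apply] using
    Polynomial.natDegree_linear_le (a := M₁ i j) (b := M₀ i j)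

theorem revPoly_one_pencil (M₁ M₀ : Matrix a b F) :
    revPoly 1 (pencil M₁ M₀) = pencil M₀ M₁ := by
  ext i j k
  simp only [revPoly, pencil, Matrix.map_apply, Matrix.add_apply, Polynomial.reflect_add,
    Polynomial.reflect_C_mul, Polynomial.reflect_C]
  rw [← pow_one (Polynomial.X : F[X]), Polynomial.reflect_monomial]
  simp [Polynomial.revAt_le, add_comm]

theorem toRat_pencil_map_recip (M₁ M₀ : Matrix a b F) :
    (toRat (pencil M₁ M₀)).map recip
      = (RatFunc.X : RatFunc F)⁻¹ • toRat (pencil M₀ M₁) := by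
  ext1 i j
  have hX : (RatFunc.X : RatFunc F) ≠ 0 := RatFunc.X_ne_zero
  simp only [toRat, Matrix.map_apply, Matrix.smul_apply, recip_algebraMap, pencil,
    Matrix.add_apply, smul_eq_mul]
  simp only [Polynomial.eval₂_add, Polynomial.eval₂_mul, Polynomial.eval₂_C,
    Polynomial.eval₂_X, map_add, map_mul, RatFunc.algebraMap_C, RatFunc.algebraMap_X]
  field_simp
  ring

end Pencil

theorem toRat_mul {F : Type*} [Field F] {a b c : Type*} [Fintype a] (P : Matrix b a F[X])
    (Q : Matrix a c F[X]) : toRat (P * Q) = toRat P * toRat Q := Matrix.map_mul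

section Inverse

variable {F : Type*} [Field F] {a b c : Type*} [Fintype a] [DecidableEq a]

theorem map_inv_of_det_ne_zero {K : Type*} [Field K] (f : K →+* K) {M : Matrix a a K}
    (hM : M.det ≠ 0) : (M⁻¹).map f = (M.map f)⁻¹ := by
  symm
  apply Matrix.inv_eq_right_inv
  rw [← Matrix.map_mul, Matrix.mul_nonsing_inv _ (isUnit_iff_ne_zero.2 hM),
    Matrix.map_one _ (map_zero f) (map_one f)]

theorem det_toRat (P : Matrix a a F[X]) :
    (toRat P).det = algebraMap F[X] (RatFunc F) P.det := by
  rw [toRat, ← RingHom.mapMatrix_apply, RingHom.map_det]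

theorem det_toRat_ne_zero {P : Matrix a a F[X]} (hP : P.det ≠ 0) : (toRat P).det ≠ 0 := by
  rw [det_toRat]
  exact RatFunc.algebraMap_ne_zero hP

theorem toRat_add (P Q : Matrix b c F[X]) : toRat (P + Q) = toRat P + toRat Q := by
  ext1 i j
  simp [toRat]

theorem toRat_sub (P Q : Matrix b c F[X]) : toRat (P - Q) = toRat P - toRat Q := by
  ext1 i j
  simp [toRat]

end Inverse

/-! ### Full rank and one-sided inverses -/

section Rank

variable {F : Type*} [Field F] {a b : Type*} [Fintype a] [DecidableEq a] [Fintype b]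

theorem exists_right_inverse_of_rank {M : Matrix a b F} (h : M.rank = Fintype.card a) :
    ∃ N : Matrix b a F, M * N = 1 := by
  rw [← Matrix.mulVec_surjective_iff_exists_right_inverse]
  have htop : LinearMap.range M.mulVecLin = ⊤ := by
    apply Submodule.eq_top_of_finrank_eq
    rw [Module.finrank_pi]
    exact h
  exact LinearMap.range_eq_top.1 htop

theorem exists_left_inverse_of_rank {M : Matrix b a F} (h : M.rank = Fintype.card a) :
    ∃ N : Matrix a b F, N * M = 1 := by
  obtain ⟨N, hN⟩ := exists_right_inverse_of_rank (M := M.transpose)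
    (by rw [Matrix.rank_transpose, h])
  exact ⟨N.transpose, by rw [← Matrix.transpose_inj, Matrix.transpose_mul,
    Matrix.transpose_transpose, hN, Matrix.transpose_one]⟩

theorem rank_fromRows_of_isUnit {M : Matrix a a F} (hM : IsUnit M) (N : Matrix b a F) :
    (Matrix.fromRows M N).rank = Fintype.card a := by
  refine le_antisymm (Matrix.rank_le_card_width _) ?_
  have e : (Matrix.fromCols 1 0 : Matrix a (a ⊕ b) F) * Matrix.fromRows M N = M := by
    rw [Matrix.fromCols_mul_fromRows, Matrix.one_mul, Matrix.zero_mul, add_zero]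
  calc Fintype.card a = M.rank := (Matrix.rank_of_isUnit M hM).symm
    _ ≤ _ := by nth_rewrite 1 [← e]; exact Matrix.rank_mul_le_right _ _

theorem rank_fromCols_of_isUnit {M : Matrix a a F} (hM : IsUnit M) (N : Matrix a b F) :
    (Matrix.fromCols M N).rank = Fintype.card a := by
  rw [← Matrix.rank_transpose, Matrix.transpose_fromCols]
  exact rank_fromRows_of_isUnit ((Matrix.isUnit_transpose M).2 hM) _

end Rank

/-! ### Transfer functions at infinity -/

namespace LinearSystemMatrix

variable {F : Type*} [Field F] {n p m q r : ℕ} (L : LinearSystemMatrix F n q r)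

/-- The reversal of grade `1` of the transfer function matrix is the transfer function matrix of the
reversed system matrix. -/
theorem revGrade_one_transfer : revGrade 1 L.transfer
    = toRat (pencil L.D₀ L.D₁) + toRat (pencil L.C₀ L.C₁) * (toRat (pencil L.A₀ L.A₁))⁻¹
      * toRat (pencil L.B₀ L.B₁) := by
  have hX : (RatFunc.X : RatFunc F) ≠ 0 := RatFunc.X_ne_zero
  have hA : (toRat (pencil L.A₁ L.A₀)).det ≠ 0 := det_toRat_ne_zero L.nonsingular
  have hA' : (toRat (pencil L.A₀ L.A₁)).det ≠ 0 := by
    intro h0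
    have h₁ : ((toRat (pencil L.A₁ L.A₀)).map recip).det = 0 := by
      rw [toRat_pencil_map_recip, Matrix.det_smul, h0, mul_zero]
    rw [← RingHom.mapMatrix_apply, ← RingHom.map_det, map_eq_zero] at h₁
    exact hA h₁
  let _ : Invertible (RatFunc.X : RatFunc F)⁻¹ := invertibleOfNonzero (inv_ne_zero hX)
  -- The factor `λ` of the inverted state block absorbs one of the two factors `λ⁻¹` of `C` and `B`.
  have hinv : ((toRat (pencil L.A₁ L.A₀))⁻¹).map recip
      = (RatFunc.X : RatFunc F) • (toRat (pencil L.A₀ L.A₁))⁻¹ := by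
    rw [map_inv_of_det_ne_zero _ hA, toRat_pencil_map_recip,
      Matrix.inv_smul _ _ (isUnit_iff_ne_zero.2 hA'), invOf_eq_inv, inv_inv]
  rw [revGrade_eq_smul, zpow_one, transfer, Matrix.map_add _ (map_add recip), Matrix.map_mul,
    Matrix.map_mul, A, B, C, D, hinv]
  simp only [toRat_pencil_map_recip, Matrix.smul_mul, Matrix.mul_smul, smul_add, smul_smul]
  simp [hX]

variable {L}

theorem isRegularAt_zero_reversed (hA : IsUnit L.A₁) :
    IsRegularAt 0 (toRat (pencil L.A₀ L.A₁)) := by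
  refine ⟨isDefinedAt_toRat _ _, ?_⟩
  rw [valueAt_toRat, pencil_map_eval, zero_smul, zero_add]
  exact ((Matrix.isUnit_iff_isUnit_det _).1 hA).ne_zero

/-- The reversal of grade `1` of the transfer function matrix is defined at the origin, with value
the feedthrough matrix `D₁ + C₁ * A₁⁻¹ * B₁`. -/
theorem revGrade_one_transfer_at_zero (hA : IsUnit L.A₁) :
    IsDefinedAt 0 (revGrade 1 L.transfer) ∧
      valueAt 0 (revGrade 1 L.transfer) = L.D₁ + L.C₁ * L.A₁⁻¹ * L.B₁ := by
  have hreg := isRegularAt_zero_reversed hA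
  obtain ⟨S, hS, e, -⟩ := hreg.exists_inverse
  have hC := isDefinedAt_toRat 0 (pencil L.C₀ L.C₁)
  have hB := isDefinedAt_toRat 0 (pencil L.B₀ L.B₁)
  have hD := isDefinedAt_toRat 0 (pencil L.D₀ L.D₁)
  have hval : valueAt 0 S = L.A₁⁻¹ := by
    have h := congrArg (valueAt 0) e
    rw [valueAt_mul hreg.1 hS, valueAt_toRat, pencil_map_eval, zero_smul, zero_add,
      valueAt_one] at h
    exact (Matrix.inv_eq_right_inv h).symm
  rw [revGrade_one_transfer, Matrix.inv_eq_right_inv e]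
  refine ⟨hD.add ((hC.mul hS).mul hB), ?_⟩
  rw [valueAt_add hD ((hC.mul hS).mul hB), valueAt_mul (hC.mul hS) hB, valueAt_mul hC hS, hval]
  simp only [valueAt_toRat, pencil_map_eval, zero_smul, zero_add]

theorem revGrade_zero_transfer_eq :
    revGrade 0 L.transfer = (RatFunc.X : RatFunc F)⁻¹ • revGrade 1 L.transfer := by
  rw [revGrade_eq_zpow_smul_revGrade 0 1, zero_sub, zpow_neg_one]

/-- If the feedthrough matrix vanishes, then the transfer function matrix is proper. -/
theorem isDefinedAt_revGrade_zero_transfer (hA : IsUnit L.A₁)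
    (hE : L.D₁ + L.C₁ * L.A₁⁻¹ * L.B₁ = 0) : IsDefinedAt 0 (revGrade 0 L.transfer) := by
  obtain ⟨hdef, hval⟩ := revGrade_one_transfer_at_zero hA
  rw [hE] at hval
  rw [revGrade_zero_transfer_eq]
  exact fun i j => X_inv_mul_mem_localRing (hdef i j) (congrFun (congrFun hval i) j)

theorem polyGrade_transfer_eq_zero (hA : IsUnit L.A₁)
    (hE : L.D₁ + L.C₁ * L.A₁⁻¹ * L.B₁ = 0) : polyGrade L.transfer = 0 :=
  Nat.le_zero.1 (polyGrade_le_iff.2 (isDefinedAt_revGrade_zero_transfer hA hE))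

theorem polyGrade_transfer_eq_one (hA : IsUnit L.A₁)
    (hE : L.D₁ + L.C₁ * L.A₁⁻¹ * L.B₁ ≠ 0) : polyGrade L.transfer = 1 := by
  obtain ⟨hdef, hval⟩ := revGrade_one_transfer_at_zero hA
  refine le_antisymm (polyGrade_le_iff.2 hdef) (Nat.one_le_iff_ne_zero.2 fun h0 => hE ?_)
  have hdef' : IsDefinedAt 0 (revGrade 0 L.transfer) := polyGrade_le_iff.1 h0.le
  rw [← hval, revGrade_eq_zpow_smul_revGrade 1 0, sub_zero, zpow_one]
  exact valueAt_smul_of_eval_eq_zero (X_mem_localRing 0) (RatFunc.eval_X _ _) hdef'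

/-! ### Degree and minimality of the system matrix -/

theorem degree_eq_one (hn : 0 < n) (hA : IsUnit L.A₁) : L.degree = 1 := by
  refine le_antisymm (matDegree_le_iff.2 ?_) ?_
  · rintro (i | i) (j | j)
    · exact natDegree_pencil_le _ _ i j
    · exact natDegree_pencil_le _ _ i j
    · have := natDegree_pencil_le L.C₁ L.C₀ i j
      simpa [toMatrix, C] using this
    · exact natDegree_pencil_le _ _ i j
  · by_contra! hlt
    have h0 := matDegree_le_iff.1 (Nat.lt_one_iff.1 hlt).le
    have hA0 : L.A₁ = 0 := by
      ext i j
      have hij : (pencil L.A₁ L.A₀ i j).natDegree ≤ 0 := h0 (.inl i) (.inl j)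
      have := Polynomial.coeff_eq_zero_of_natDegree_lt (Nat.lt_of_le_of_lt hij one_pos)
      simpa [pencil, Polynomial.coeff_C] using this
    have : Nonempty (Fin n) := ⟨⟨0, hn⟩⟩
    rw [hA0] at hA
    exact not_isUnit_zero hA

theorem degree_eq_of_isEmpty {L : LinearSystemMatrix F 0 q r} :
    L.degree = matDegree L.D := by
  refine eq_of_forall_ge_iff fun d => ?_
  rw [degree, matDegree_le_iff, matDegree_le_iff]
  constructor
  · exact fun h i j => h (.inr i) (.inr j)
  · rintro h (i | i) (j | j)
    exacts [i.elim0, i.elim0, j.elim0, h i j]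

theorem transfer_eq_of_isEmpty {L : LinearSystemMatrix F 0 q r} : L.transfer = toRat L.D := by
  rw [transfer, add_eq_left]
  ext i j
  simp [Matrix.mul_apply]

theorem isMinimalAt_of_isEmpty (A : Matrix (Fin 0) (Fin 0) F[X]) (B : Matrix (Fin 0) (Fin r) F[X])
    (C : Matrix (Fin q) (Fin 0) F[X]) (x₀ : F) : IsMinimalAt A B C x₀ :=
  ⟨Nat.le_zero.1 ((Matrix.rank_le_card_width _).trans (by simp)),
    Nat.le_zero.1 ((Matrix.rank_le_card_height _).trans (by simp))⟩

theorem isMinimalAt_revPoly (hA : IsUnit L.A₁) :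
    IsMinimalAt (revPoly 1 L.A) (revPoly 1 L.B) (revPoly 1 L.C) 0 := by
  rw [IsMinimalAt, A, B, C, revPoly_one_pencil, revPoly_one_pencil, revPoly_one_pencil,
    pencil_map_eval, pencil_map_eval, pencil_map_eval, zero_smul, zero_add, zero_smul, zero_add, zero_smul,
    zero_add]
  exact ⟨by simpa using rank_fromRows_of_isUnit hA L.C₁,
    by simpa using rank_fromCols_of_isUnit hA L.B₁⟩

/-- If the transfer function matrix is zero, then the state matrix is invertible at every point
where the system is minimal: with `M` and `N` polynomial combinations `A * X₀ + B * Y₀` and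
`Z₀ * A + W₀ * C` that are the identity at `x₀`, the matrix `N * A⁻¹ * M` is polynomial, which
forces `A` to be invertible at `x₀`. -/
theorem det_eval_ne_zero_of_transfer_eq_zero {x₀ : F} (hmin : IsMinimalAt L.A L.B L.C x₀)
    (hT : L.transfer = 0) : L.A.det.eval x₀ ≠ 0 := by
  intro hroot
  obtain ⟨hrow, hcol⟩ := hmin
  obtain ⟨R, hR⟩ := exists_right_inverse_of_rank (hcol.trans (Fintype.card_fin n).symm)
  obtain ⟨S, hS⟩ := exists_left_inverse_of_rank (hrow.trans (Fintype.card_fin n).symm)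
  obtain ⟨X₀, Y₀, rfl⟩ : ∃ X₀ Y₀, R = Matrix.fromRows X₀ Y₀ := ⟨_, _, (R.fromRows_toRows).symm⟩
  obtain ⟨Z₀, W₀, rfl⟩ : ∃ Z₀ W₀, S = Matrix.fromCols Z₀ W₀ := ⟨_, _, (S.fromCols_toCols).symm⟩
  rw [Matrix.fromCols_mul_fromRows] at hR hS
  obtain ⟨M, hM⟩ : ∃ M, M = L.A * X₀.map Polynomial.C + L.B * Y₀.map Polynomial.C := ⟨_, rfl⟩
  obtain ⟨N, hN⟩ : ∃ N, N = Z₀.map Polynomial.C * L.A + W₀.map Polynomial.C * L.C := ⟨_, rfl⟩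
  obtain ⟨T, hTdef⟩ : ∃ T, T = Z₀.map Polynomial.C * M
    + W₀.map Polynomial.C * (L.C * X₀.map Polynomial.C - L.D * Y₀.map Polynomial.C) := ⟨_, rfl⟩
  have hAdet : (toRat L.A).det ≠ 0 := det_toRat_ne_zero L.nonsingular
  have hAu := isUnit_iff_ne_zero.2 hAdet
  -- `C * A⁻¹ * M` is polynomial because `C * A⁻¹ * B = -D`.
  have hCB : toRat L.C * ((toRat L.A)⁻¹ * toRat L.B) = -toRat L.D := by
    rw [transfer] at hT
    rw [← Matrix.mul_assoc]
    exact eq_neg_of_add_eq_zero_right hT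
  have key : toRat N * ((toRat L.A)⁻¹ * toRat M) = toRat T := by
    have h₁ : toRat L.C * ((toRat L.A)⁻¹ * toRat M)
        = toRat (L.C * X₀.map Polynomial.C - L.D * Y₀.map Polynomial.C) := by
      rw [hM, toRat_add, toRat_mul, toRat_mul, Matrix.mul_add, ← Matrix.mul_assoc _ (toRat L.A),
        Matrix.nonsing_inv_mul _ hAu, Matrix.one_mul, Matrix.mul_add,
        ← Matrix.mul_assoc _ (toRat L.B), ← Matrix.mul_assoc (toRat L.C) (_ * _), hCB, toRat_sub,
        toRat_mul, toRat_mul, Matrix.neg_mul,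
        sub_eq_add_neg]
    rw [hN, toRat_add, toRat_mul, toRat_mul, Matrix.add_mul, Matrix.mul_assoc _ (toRat L.A),
      ← Matrix.mul_assoc (toRat L.A), Matrix.mul_nonsing_inv _ hAu, Matrix.one_mul,
      Matrix.mul_assoc _ (toRat L.C), h₁, hTdef, toRat_add, toRat_mul, toRat_mul]
  have hdet : N.det * M.det = L.A.det * T.det := by
    apply RatFunc.algebraMap_injective F
    rw [map_mul, map_mul, ← det_toRat, ← det_toRat, ← det_toRat, ← det_toRat, ← key,
      Matrix.det_mul, Matrix.det_mul, Matrix.det_nonsing_inv, Ring.inverse_eq_inv']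
    field_simp
  have hmap : ∀ {c d : Type} (Z : Matrix c d F),
      (Z.map Polynomial.C).map (Polynomial.evalRingHom x₀) = Z := by
    intro c d Z
    ext i j
    simp
  have hMv : M.map (Polynomial.evalRingHom x₀) = 1 := by
    rw [hM, Matrix.map_add _ (map_add _), Matrix.map_mul, Matrix.map_mul, hmap, hmap]
    exact hR
  have hNv : N.map (Polynomial.evalRingHom x₀) = 1 := by
    rw [hN, Matrix.map_add _ (map_add _), Matrix.map_mul, Matrix.map_mul, hmap, hmap]
    exact hS
  have hev := congrArg (Polynomial.evalRingHom x₀) hdet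
  rw [map_mul, map_mul, RingHom.map_det, RingHom.map_det, RingHom.mapMatrix_apply,
    RingHom.mapMatrix_apply, hMv, hNv, Matrix.det_one, Polynomial.coe_evalRingHom, hroot, zero_mul,
    mul_one] at hev
  exact one_ne_zero hev

/-- A state matrix of positive size with invertible leading coefficient is singular at some point of
an algebraically closed field; minimality at that point makes the transfer function matrix nonzero.
-/
theorem transfer_ne_zero [IsAlgClosed F] (hn : 0 < n) (hA : IsUnit L.A₁)
    (hmin : ∀ x₀, IsMinimalAt L.A L.B L.C x₀) : L.transfer ≠ 0 := by
  intro hT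
  have hpencil : L.A = (Polynomial.X : F[X]) • L.A₁.map Polynomial.C + L.A₀.map Polynomial.C := by
    ext1 i j
    simp [A, pencil, mul_comm (Polynomial.X : F[X])]
  have hcoeff : L.A.det.coeff n ≠ 0 := by
    have h := Polynomial.coeff_det_X_add_C_card L.A₁ L.A₀
    rw [Fintype.card_fin, ← hpencil] at h
    rw [h]
    exact ((Matrix.isUnit_iff_isUnit_det _).1 hA).ne_zero
  have hdeg : L.A.det.degree ≠ 0 := by
    intro h0
    exact hcoeff (Polynomial.coeff_eq_zero_of_degree_lt (by rw [h0]; exact_mod_cast hn))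
  obtain ⟨x₀, hx₀⟩ := IsAlgClosed.exists_root _ hdeg
  exact det_eval_ne_zero_of_transfer_eq_zero (hmin x₀) hT hx₀

end LinearSystemMatrix

/-! ### Grades of strong linearizations -/

section Grade

variable {F : Type*} [Field F] {p m q r : ℕ} {G : Matrix (Fin p) (Fin m) (RatFunc F)}
  {H : Matrix (Fin q) (Fin r) (RatFunc F)}

/-- For matrices of the same size, the identity blocks can be cancelled, so that scaling is
compatible with extension equivalence. This fails for different sizes, since the identity blocks are
not scaled. -/
theorem ExtEquivAt.smul {G H : Matrix (Fin p) (Fin m) (RatFunc F)} {x₀ : F}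
    (h : ExtEquivAt x₀ G H) (f : RatFunc F) : ExtEquivAt x₀ (f • G) (f • H) := by
  obtain ⟨s₁, s₂, hrow, -, e⟩ := h.exists_localEquiv
  obtain rfl : s₁ = s₂ := by omega
  exact (e.cancel.smul f).extEquivAt

theorem isDefinedAt_zpow_smul {M : Matrix (Fin p) (Fin m) (RatFunc F)} (hM : IsDefinedAt 0 M)
    {k : ℤ} (hk : 0 < k) : IsDefinedAt 0 ((RatFunc.X : RatFunc F) ^ k • M) ∧
      valueAt 0 ((RatFunc.X : RatFunc F) ^ k • M) = 0 := by
  obtain ⟨j, hj⟩ : ∃ j : ℕ, k = (j + 1 : ℕ) := Int.eq_succ_of_zero_lt hk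
  have hpow := (localRing (0 : F)).pow_mem (X_mem_localRing 0) (j + 1)
  rw [hj, zpow_natCast]
  refine ⟨hM.smul hpow, valueAt_smul_of_eval_eq_zero hpow ?_ hM⟩
  rw [pow_succ, RatFunc.eval_mul _ _ ((localRing (0 : F)).pow_mem (X_mem_localRing 0) j)
    (X_mem_localRing 0), RatFunc.eval_X, mul_zero]

/-- Two matrices `G` and `H` of different sizes cannot be equivalent at the origin, after extension
by identities, together with `λ ^ k * G` and `λ * H`, if `H ≠ 0` is defined at the origin. If `H`
is larger, the identity block on the side of `λ ^ k * G` is too large for the value of `λ * H`. If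
`G` is larger, the same comparison of identity blocks excludes `k > 0` and `k < 0`; for `k = 0` the
matrices `H` and `λ * H` would be equivalent. -/
theorem not_extEquivAt_of_size_ne (hpq : p ≠ q) (hH : IsDefinedAt 0 H) (hne : H ≠ 0)
    (h : ExtEquivAt 0 G H) (k : ℤ) :
    ¬ ExtEquivAt 0 ((RatFunc.X : RatFunc F) ^ k • G) ((RatFunc.X : RatFunc F) • H) := by
  intro h'
  obtain ⟨s₁, s₂, hrow, hcol, e⟩ := h.exists_localEquiv
  obtain ⟨t₁, t₂, hrow', hcol', e'⟩ := h'.exists_localEquiv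
  have hXH := isDefinedAt_zpow_smul hH one_pos
  rw [zpow_one] at hXH
  have hG : IsDefinedAt 0 G := e.isDefinedAt hH
  have hkG := e'.isDefinedAt hXH.1
  -- This bound excludes `p < q`, where `t₁ > t₂`.
  have hle := e'.card_le hXH.1 hXH.2
  rw [Fintype.card_fin, Fintype.card_fin] at hle
  rcases lt_trichotomy k 0 with hk | rfl | hk
  · -- Here `k < 0`, and `G` is a positive power of the variable times a defined matrix.
    have hG' := isDefinedAt_zpow_smul hkG (neg_pos.2 hk)
    rw [smul_smul, ← zpow_add₀ RatFunc.X_ne_zero, neg_add_cancel, zpow_zero, one_smul] at hG'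
    have := e.symm.card_le hG'.1 hG'.2
    rw [Fintype.card_fin, Fintype.card_fin] at this
    omega
  · rw [zpow_zero, one_smul] at e'
    -- Both equivalences are extended to a common identity block on the side of `G`.
    have e₁ := (localEquiv_extendOne_extendOne 0 G (finSumFinEquiv (m := s₁) (n := t₁)).symm).symm
    have f₁ := (localEquiv_extendOne_extendOne 0 G
      ((finCongr (Nat.add_comm s₁ t₁)).trans (finSumFinEquiv (m := t₁) (n := s₁)).symm))
    have e₂ := localEquiv_extendOne_extendOne 0 H (finSumFinEquiv (m := s₂) (n := t₁)).symm
    have hst : s₂ + t₁ = t₂ + s₁ := by omega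
    have f₂ := localEquiv_extendOne_extendOne 0 ((RatFunc.X : RatFunc F) • H)
      ((finCongr hst).trans (finSumFinEquiv (m := t₂) (n := s₁)).symm)
    have hHH := ((e₂.symm.trans (e.extendOne (Fin t₁)).symm).trans e₁.symm).trans
      ((f₁.symm.trans (e'.extendOne (Fin s₁))).trans f₂)
    exact hne (eq_zero_of_localEquiv_X_smul hHH.cancel hH)
  · have hG' := isDefinedAt_zpow_smul hG hk
    have := e'.symm.card_le hG'.1 hG'.2
    rw [Fintype.card_fin, Fintype.card_fin] at this
    omega

theorem revGrade_zero_eq_zero_iff {a b : Type*} {M : Matrix a b (RatFunc F)} :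
    revGrade 0 M = 0 ↔ M = 0 := by
  rw [revGrade_eq_smul, zpow_zero, one_smul]
  constructor
  · intro h
    ext1 i j
    have := congrFun (congrFun h i) j
    exact (map_eq_zero recip).1 this
  · rintro rfl
    ext1 i j
    simp

end Grade

end RatLin

theorem proposition4p17 {F : Type*} [Field F] [IsAlgClosed F] {n p m q r : ℕ}
    (G : Matrix (Fin p) (Fin m) (RatFunc F)) (L : RatLin.LinearSystemMatrix F n q r)
    (hL : L.IsStrongLinearization G) :
    (n = 0 ∨ L.D₁ + L.C₁ * L.A₁⁻¹ * L.B₁ ≠ 0 →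
      L.IsGradeStrongLinearization G (RatLin.polyGrade G : ℤ)) ∧
    (0 < n → L.D₁ + L.C₁ * L.A₁⁻¹ * L.B₁ = 0 → q = p → r = m →
      L.IsGradeStrongLinearization G ((RatLin.polyGrade G : ℤ) + 1)) ∧
    (0 < n → L.D₁ + L.C₁ * L.A₁⁻¹ * L.B₁ = 0 → (q ≠ p ∨ r ≠ m) →
      ∀ g : ℤ, ¬ L.IsGradeStrongLinearization G g) := by
  obtain ⟨hlin, hA, hrev⟩ := hL
  rw [RatLin.rev, RatLin.rev] at hrev
  refine ⟨fun hE => ⟨hlin, ?_⟩, fun hn hE hqp hrm => ⟨hlin, ?_⟩, fun hn hE hsize g hg => ?_⟩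
  · rcases Nat.eq_zero_or_pos n with rfl | hn
    · refine ⟨RatLin.LinearSystemMatrix.isMinimalAt_of_isEmpty _ _ _ _, ?_⟩
      rwa [RatLin.LinearSystemMatrix.degree_eq_of_isEmpty, ← RatLin.polyGrade_toRat,
        ← RatLin.LinearSystemMatrix.transfer_eq_of_isEmpty]
    · have hgrade := RatLin.LinearSystemMatrix.polyGrade_transfer_eq_one (hA hn)
        (hE.resolve_left hn.ne')
      rw [RatLin.LinearSystemMatrix.IsLinearizationAtInfty,
        RatLin.LinearSystemMatrix.degree_eq_one hn (hA hn)]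
      rw [hgrade] at hrev
      exact ⟨RatLin.LinearSystemMatrix.isMinimalAt_revPoly (hA hn), hrev⟩
  · subst hqp hrm
    rw [RatLin.LinearSystemMatrix.polyGrade_transfer_eq_zero (hA hn) hE] at hrev
    rw [RatLin.LinearSystemMatrix.IsLinearizationAtInfty,
      RatLin.LinearSystemMatrix.degree_eq_one hn (hA hn)]
    refine ⟨RatLin.LinearSystemMatrix.isMinimalAt_revPoly (hA hn), ?_⟩
    have h := RatLin.ExtEquivAt.smul hrev RatFunc.X
    rw [RatLin.revGrade_eq_zpow_smul_revGrade _ (RatLin.polyGrade G : ℤ) G, add_sub_cancel_left,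
      zpow_one, RatLin.revGrade_eq_zpow_smul_revGrade _ ((0 : ℕ) : ℤ) L.transfer]
    simpa using h
  · rw [RatLin.LinearSystemMatrix.polyGrade_transfer_eq_zero (hA hn) hE, Nat.cast_zero] at hrev
    obtain ⟨-, -, hinf⟩ := hg
    rw [RatLin.LinearSystemMatrix.degree_eq_one hn (hA hn), Nat.cast_one,
      RatLin.revGrade_eq_zpow_smul_revGrade g (RatLin.polyGrade G : ℤ) G,
      RatLin.revGrade_eq_zpow_smul_revGrade 1 0 L.transfer, sub_zero, zpow_one] at hinf
    have hpq : p ≠ q := by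
      obtain ⟨s₁, s₂, hrow, hcol, -⟩ := hrev
      omega
    refine RatLin.not_extEquivAt_of_size_ne hpq
      (RatLin.LinearSystemMatrix.isDefinedAt_revGrade_zero_transfer (hA hn) hE) ?_ hrev _ hinf
    rw [Ne, RatLin.revGrade_zero_eq_zero_iff]
    exact RatLin.LinearSystemMatrix.transfer_ne_zero hn (hA hn) fun x₀ => (hlin x₀ trivial).1
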